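/- A Salem number is a real algebraic integer $\alpha>1$ such that all its Galois conjugates (the complex roots other than $\alpha$ of its minimal polynomial over $\mathbb{Q}$) have absolute value at most $1$ and at least one of them has absolute value equal to $1$. Let $m\ge 1$ be an integer. For real $H$, the set $\mathrm{Sal}_m(H)$ of all Salem numbers $\alpha$ of degree $2(m+1)$ with $1<\alpha\le H$ is finite, and \[ \#\mathrm{Sal}_m(H)=\omega_m\,H^{m+1}+O\left(H^{m}\right),\qquad H\to\infty, \] where the implied constant depends only on $m$ and \[ \omega_m=\frac{2^{m(m+1)}}{m+1}\prod_{k=0}^{m-1}\frac{k!^2}{(2k+1)!}. \] -/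

import Mathlib

open Asymptotics Filter

/-- The Galois conjugates of a real number `α`: the complex roots of its minimal polynomial
over `ℚ` other than `α` itself. -/
def galoisConjugates (α : ℝ) : Set ℂ :=
  {z | Polynomial.aeval z (minpoly ℚ α) = 0 ∧ z ≠ (α : ℂ)}

/-- A Salem number: a real algebraic integer `α > 1` all of whose Galois conjugates have absolute
value at most `1`, at least one of them having absolute value equal to `1`. -/
def IsSalem (α : ℝ) : Prop :=
  IsIntegral ℤ α ∧ 1 < α ∧ (∀ z ∈ galoisConjugates α, ‖z‖ ≤ 1) ∧
    ∃ z ∈ galoisConjugates α, ‖z‖ = 1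

/-- The Salem numbers of degree `2 (m + 1)` that are at most `H`. -/
def salemSet (m : ℕ) (H : ℝ) : Set ℝ :=
  {α | IsSalem α ∧ (minpoly ℚ α).natDegree = 2 * (m + 1) ∧ α ≤ H}

/-- The leading constant `ω_m`. -/
noncomputable def salemOmega (m : ℕ) : ℝ :=
  (2 : ℝ) ^ (m * (m + 1)) / ((m : ℝ) + 1) *
    ∏ k ∈ Finset.range m, (k.factorial : ℝ) ^ 2 / ((2 * k + 1).factorial : ℝ)

open Polynomial in
/-- The monic polynomial with roots `θ i`, counted with multiplicity. -/
noncomputable def rootPoly {ι : Type*} {R : Type*} [CommRing R] (s : Finset ι) (θ : ι → R) : R[X] :=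
  ∏ i ∈ s, (X - C (θ i))

/-- The non-leading coefficients of the monic polynomial with roots `θ i`. -/
noncomputable def rootCoeff {n : ℕ} (θ : Fin n → ℝ) : Fin n → ℝ :=
  fun k => (rootPoly Finset.univ θ).coeff k

/-- The absolute value of the Vandermonde determinant. -/
noncomputable def vdmAbs {n : ℕ} (θ : Fin n → ℝ) : ℝ := |(Matrix.vandermonde θ).det|

section RootPoly
open Polynomial
variable {ι R : Type*} [CommRing R]

theorem rootPoly_insert [DecidableEq ι] {s : Finset ι} {a : ι} (h : a ∉ s) (θ : ι → R) :
    rootPoly (insert a s) θ = (X - C (θ a)) * rootPoly s θ := by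
  simp [rootPoly, Finset.prod_insert h]

theorem rootPoly_monic (s : Finset ι) (θ : ι → R) : (rootPoly s θ).Monic :=
  monic_prod_of_monic _ _ fun i _ => monic_X_sub_C (θ i)

theorem rootPoly_natDegree [Nontrivial R] (s : Finset ι) (θ : ι → R) :
    (rootPoly s θ).natDegree = s.card := by
  rw [rootPoly, natDegree_prod_of_monic _ _ fun i _ => monic_X_sub_C (θ i)]
  simp

theorem rootPoly_eval (s : Finset ι) (θ : ι → R) (x : R) :
    (rootPoly s θ).eval x = ∏ i ∈ s, (x - θ i) := by
  simp [rootPoly, eval_prod]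

theorem coeff_X_sub_C_mul_zero (a : R) (p : R[X]) :
    ((X - C a) * p).coeff 0 = - (a * p.coeff 0) := by
  simp [sub_mul]

theorem coeff_X_sub_C_mul_succ (a : R) (p : R[X]) (k : ℕ) :
    ((X - C a) * p).coeff (k + 1) = p.coeff k - a * p.coeff (k + 1) := by
  simp [sub_mul, coeff_X_mul]

end RootPoly

section Derivative
open Polynomial

theorem contDiff_rootPoly_coeff {ι : Type*} [Fintype ι] (s : Finset ι) (k : ℕ) :
    ContDiff ℝ 1 (fun θ : ι → ℝ => (rootPoly s θ).coeff k) := by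
  classical
  induction s using Finset.induction_on generalizing k with
  | empty => simpa [rootPoly] using contDiff_const
  | insert a s ha ih =>
    simp only [rootPoly_insert ha]
    cases k with
    | zero =>
      simp only [coeff_X_sub_C_mul_zero]
      exact ((contDiff_apply ℝ ℝ a).mul (ih 0)).neg
    | succ k =>
      simp only [coeff_X_sub_C_mul_succ]
      exact (ih k).sub ((contDiff_apply ℝ ℝ a).mul (ih (k + 1)))

theorem hasStrictFDerivAt_rootPoly_coeff {ι : Type*} [Fintype ι] [DecidableEq ι] (s : Finset ι)
    (k : ℕ) (θ : ι → ℝ) :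
    HasStrictFDerivAt (fun θ : ι → ℝ => (rootPoly s θ).coeff k)
      (∑ i ∈ s, (-(rootPoly (s.erase i) θ).coeff k) •
        (ContinuousLinearMap.proj i : (ι → ℝ) →L[ℝ] ℝ)) θ := by
  induction s using Finset.induction_on generalizing k with
  | empty => simpa [rootPoly] using hasStrictFDerivAt_const (𝕜 := ℝ) _ θ
  | insert a s ha ih =>
    have hp : HasStrictFDerivAt (fun θ : ι → ℝ => θ a)
      (ContinuousLinearMap.proj a : (ι → ℝ) →L[ℝ] ℝ) θ :=
      (ContinuousLinearMap.proj a : (ι → ℝ) →L[ℝ] ℝ).hasStrictFDerivAt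
    have he : ∀ i ∈ s, rootPoly ((insert a s).erase i) θ = (X - C (θ a)) * rootPoly (s.erase i) θ := by
      intro i hi
      have hia : a ≠ i := fun h => ha (h ▸ hi)
      rw [Finset.erase_insert_of_ne hia, rootPoly_insert]
      exact fun h => ha (Finset.mem_of_mem_erase h)
    rw [Finset.sum_insert ha, Finset.erase_insert ha]
    simp only [rootPoly_insert ha]
    rw [Finset.sum_congr rfl fun i hi => by rw [he i hi]]
    cases k with
    | zero =>
      simp only [coeff_X_sub_C_mul_zero]
      refine (hp.mul (ih 0)).neg.congr_fderiv ?_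
      ext v
      simp [Finset.mul_sum, mul_comm, mul_left_comm]
    | succ k =>
      simp only [coeff_X_sub_C_mul_succ]
      refine ((ih k).sub (hp.mul (ih (k + 1)))).congr_fderiv ?_
      ext v
      simp only [sub_apply, add_apply,
        smul_apply, sum_apply, ContinuousLinearMap.proj_apply,
        smul_eq_mul, Finset.mul_sum]
      rw [add_comm _ (_ * _), ← sub_sub, sub_right_comm, ← Finset.sum_sub_distrib, sub_eq_neg_add]
      congr 1
      · ring
      · exact Finset.sum_congr rfl fun i _ => by ring

/-- The Jacobian matrix of `rootCoeff`. -/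
noncomputable def rootCoeffJacobian {n : ℕ} (θ : Fin n → ℝ) : Matrix (Fin n) (Fin n) ℝ :=
  Matrix.of fun k i => -(rootPoly (Finset.univ.erase i) θ).coeff k

/-- The derivative of `rootCoeff`. -/
noncomputable def rootCoeffDeriv {n : ℕ} (θ : Fin n → ℝ) : (Fin n → ℝ) →L[ℝ] (Fin n → ℝ) :=
  LinearMap.toContinuousLinearMap (Matrix.toLin' (rootCoeffJacobian θ))

theorem hasStrictFDerivAt_rootCoeff {n : ℕ} (θ : Fin n → ℝ) :
    HasStrictFDerivAt rootCoeff (rootCoeffDeriv θ) θ := by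
  rw [hasStrictFDerivAt_pi']
  intro k
  refine (hasStrictFDerivAt_rootPoly_coeff Finset.univ (k : ℕ) θ).congr_fderiv ?_
  ext v
  simp [rootCoeffDeriv, rootCoeffJacobian, Matrix.mulVec, dotProduct]

theorem vandermonde_mul_rootCoeffJacobian {n : ℕ} (θ : Fin n → ℝ) :
    Matrix.vandermonde θ * rootCoeffJacobian θ =
      Matrix.diagonal fun i => -∏ j ∈ Finset.univ.erase i, (θ i - θ j) := by
  ext i l
  have h : ∑ k : Fin n, θ i ^ (k : ℕ) * (rootPoly (Finset.univ.erase l) θ).coeff k =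
      ∏ j ∈ Finset.univ.erase l, (θ i - θ j) := by
    rw [← rootPoly_eval, eval_eq_sum_range' (n := n), Finset.sum_range]
    · simp [mul_comm]
    · have := i.pos
      rw [rootPoly_natDegree, Finset.card_erase_of_mem (Finset.mem_univ _)]
      simp; omega
  simp only [Matrix.mul_apply, Matrix.vandermonde_apply, rootCoeffJacobian, Matrix.of_apply,
    mul_neg, Finset.sum_neg_distrib, h]
  by_cases hil : i = l
  · subst hil; simp
  · rw [Matrix.diagonal_apply_ne _ hil, Finset.prod_eq_zero (i := i)]
    · simp
    · simp [hil]
    · simp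

theorem prod_prod_erase_abs_sub {n : ℕ} (θ : Fin n → ℝ) :
    ∏ i, ∏ j ∈ Finset.univ.erase i, |θ i - θ j| = vdmAbs θ * vdmAbs θ := by
  have h := Finset.prod_prod_Ioi_mul_eq_prod_prod_off_diag (fun i j : Fin n => |θ j - θ i|)
  have h2 : ∀ i : Fin n, Finset.univ.erase i = ({i}ᶜ : Finset (Fin n)) := by
    intro i; ext; simp
  simp only [h2]
  rw [vdmAbs, Matrix.det_vandermonde, Finset.abs_prod, ← Finset.prod_mul_distrib]
  simp only [Finset.abs_prod, ← Finset.prod_mul_distrib]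
  rw [Finset.prod_sigma'] at h
  rw [← h, Finset.prod_sigma']
  refine Finset.prod_congr rfl fun x _ => ?_
  rw [abs_sub_comm (θ x.1) (θ x.2)]

theorem abs_det_rootCoeffDeriv {n : ℕ} {θ : Fin n → ℝ} (hθ : Function.Injective θ) :
    |(rootCoeffDeriv θ).det| = vdmAbs θ := by
  have h0 : vdmAbs θ ≠ 0 := abs_ne_zero.2 (Matrix.det_vandermonde_ne_zero_iff.2 hθ)
  have h := congrArg (fun M => |Matrix.det M|) (vandermonde_mul_rootCoeffJacobian θ)
  simp only [Matrix.det_mul, abs_mul, Matrix.det_diagonal, Finset.abs_prod, abs_neg] at h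
  rw [prod_prod_erase_abs_sub] at h
  have h2 : (rootCoeffDeriv θ).det = (rootCoeffJacobian θ).det := by
    rw [rootCoeffDeriv, ContinuousLinearMap.det, LinearMap.coe_toContinuousLinearMap,
      LinearMap.det_toLin']
  rw [h2]
  exact mul_left_cancel₀ h0 h

theorem map_nhds_rootCoeff {n : ℕ} {θ : Fin n → ℝ} (hθ : Function.Injective θ) :
    Filter.map rootCoeff (nhds θ) = nhds (rootCoeff θ) := by
  have h0 : (rootCoeffDeriv θ).det ≠ 0 := by
    rw [← abs_ne_zero, abs_det_rootCoeffDeriv hθ]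
    exact abs_ne_zero.2 (Matrix.det_vandermonde_ne_zero_iff.2 hθ)
  have := (hasStrictFDerivAt_rootCoeff θ)
  rw [← ContinuousLinearMap.coe_toContinuousLinearEquivOfDetNeZero _ h0] at this
  exact this.map_nhds_eq_of_equiv

theorem rootPoly_eq_of_rootCoeff_eq {n : ℕ} {p : ℝ[X]} (hp : p.Monic) (hd : p.natDegree = n)
    {θ : Fin n → ℝ} (h : ∀ k : Fin n, p.coeff k = rootCoeff θ k) :
    p = rootPoly Finset.univ θ := by
  ext k
  rcases lt_trichotomy k n with hk | hk | hk
  · exact h ⟨k, hk⟩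
  · have h1 := hp.coeff_natDegree
    have h2 := (rootPoly_monic Finset.univ θ).coeff_natDegree
    rw [rootPoly_natDegree, Finset.card_univ, Fintype.card_fin] at h2
    rw [hk, h2, ← hd, h1]
  · rw [coeff_eq_zero_of_natDegree_lt (by omega), coeff_eq_zero_of_natDegree_lt]
    rw [rootPoly_natDegree, Finset.card_univ, Fintype.card_fin]; exact hk

theorem rootPoly_eval_eq_zero_iff {n : ℕ} {R : Type*} [CommRing R] [IsDomain R] (θ : Fin n → R) (x : R) :
    (rootPoly Finset.univ θ).eval x = 0 ↔ x ∈ Set.range θ := by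
  rw [rootPoly_eval, Finset.prod_eq_zero_iff]
  simp [sub_eq_zero, eq_comm]

theorem injOn_rootCoeff (n : ℕ) : Set.InjOn (rootCoeff (n := n)) {θ | StrictAnti θ} := by
  intro θ hθ τ hτ h
  have h1 : rootPoly Finset.univ θ = rootPoly Finset.univ τ :=
    rootPoly_eq_of_rootCoeff_eq (rootPoly_monic _ _) (by simp [rootPoly_natDegree])
      fun k => congrFun h k
  refine (StrictAnti.range_inj hθ hτ).1 ?_
  ext x
  rw [← rootPoly_eval_eq_zero_iff, ← rootPoly_eval_eq_zero_iff, h1]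

theorem contDiff_rootCoeff (n : ℕ) : ContDiff ℝ 1 (rootCoeff (n := n)) :=
  contDiff_pi.2 fun k => contDiff_rootPoly_coeff Finset.univ k

end Derivative

section Selberg
open MeasureTheory

/-- The cube `[-2, 2]ⁿ`. -/
def cube (n : ℕ) : Set (Fin n → ℝ) := Set.univ.pi fun _ => Set.Icc (-2) 2

theorem mem_cube {n : ℕ} {θ : Fin n → ℝ} : θ ∈ cube n ↔ ∀ i, -2 ≤ θ i ∧ θ i ≤ 2 := by
  simp only [cube, Set.mem_univ_pi, Set.mem_Icc]

theorem isCompact_cube (n : ℕ) : IsCompact (cube n) :=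
  isCompact_univ_pi fun _ => isCompact_Icc

theorem measurableSet_cube (n : ℕ) : MeasurableSet (cube n) :=
  (isCompact_cube n).measurableSet

theorem continuous_vdmAbs (n : ℕ) : Continuous (vdmAbs (n := n)) := by
  unfold vdmAbs
  simp only [Matrix.det_vandermonde]
  fun_prop

theorem vdmAbs_nonneg {n : ℕ} (θ : Fin n → ℝ) : 0 ≤ vdmAbs θ := abs_nonneg _

theorem vdmAbs_cons {n : ℕ} (t : ℝ) (τ : Fin n → ℝ) :
    vdmAbs (Fin.cons t τ : Fin (n + 1) → ℝ) = (∏ j, |t - τ j|) * vdmAbs τ := by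
  simp only [vdmAbs, Matrix.det_vandermonde, Fin.prod_univ_succ, Fin.prod_Ioi_zero,
    Fin.prod_Ioi_succ, Fin.cons_zero, Fin.cons_succ, abs_mul, Finset.abs_prod, abs_sub_comm t]

theorem vdmAbs_comp_perm {n : ℕ} (θ : Fin n → ℝ) (σ : Equiv.Perm (Fin n)) :
    vdmAbs (θ ∘ σ) = vdmAbs θ := by
  have : Matrix.vandermonde (θ ∘ σ) = (Matrix.vandermonde θ).submatrix σ id := by
    ext i j; simp [Matrix.vandermonde_apply]
  rw [vdmAbs, this, Matrix.det_permute, abs_mul, vdmAbs]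
  rcases Int.units_eq_one_or (Equiv.Perm.sign σ) with h | h <;> simp [h]

theorem vdmAbs_eq_zero {n : ℕ} {θ : Fin n → ℝ} {i j : Fin n} (hij : i ≠ j) (h : θ i = θ j) :
    vdmAbs θ = 0 := by
  rw [vdmAbs, abs_eq_zero]
  by_contra h0
  exact hij (Matrix.det_vandermonde_ne_zero_iff.1 h0 h)

theorem piCongrLeft_symm_eq_comp {n : ℕ} (σ : Equiv.Perm (Fin n)) (θ : Fin n → ℝ) :
    MeasurableEquiv.piCongrLeft (fun _ : Fin n => ℝ) σ.symm θ = θ ∘ σ := by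
  ext i
  simpa using MeasurableEquiv.piCongrLeft_apply_apply (β := fun _ : Fin n => ℝ) σ.symm θ (σ i)

theorem piCongrLeft_symm_preimage_cube {n : ℕ} (σ : Equiv.Perm (Fin n)) :
    MeasurableEquiv.piCongrLeft (fun _ : Fin n => ℝ) σ.symm ⁻¹' cube n = cube n := by
  ext θ
  simp only [Set.mem_preimage, piCongrLeft_symm_eq_comp, mem_cube, Function.comp]
  exact ⟨fun H i => by simpa using H (σ.symm i), fun H i => H _⟩

theorem setIntegral_cube_comp_perm {n : ℕ} (σ : Equiv.Perm (Fin n)) (F : (Fin n → ℝ) → ℝ) :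
    ∫ θ in cube n, F (θ ∘ σ) = ∫ θ in cube n, F θ := by
  have h := (volume_measurePreserving_piCongrLeft (fun _ : Fin n => ℝ)
    σ.symm).setIntegral_preimage_emb (MeasurableEquiv.measurableEmbedding _) F (cube n)
  simpa only [piCongrLeft_symm_eq_comp, piCongrLeft_symm_preimage_cube] using h

theorem MeasureTheory.IntegrableOn.cube_comp_perm {n : ℕ} (σ : Equiv.Perm (Fin n))
    {F : (Fin n → ℝ) → ℝ} (hF : IntegrableOn F (cube n)) :
    IntegrableOn (fun θ => F (θ ∘ σ)) (cube n) := by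
  have h := ((volume_measurePreserving_piCongrLeft (fun _ : Fin n => ℝ)
    σ.symm).integrableOn_comp_preimage (MeasurableEquiv.measurableEmbedding _)
      (f := F) (s := cube n)).2 hF
  rw [piCongrLeft_symm_preimage_cube] at h
  exact h.congr_fun (fun θ _ => by simp only [Function.comp_apply, piCongrLeft_symm_eq_comp])
    (measurableSet_cube n)

theorem integrableOn_cube_of_continuous {n : ℕ} {F : (Fin n → ℝ) → ℝ} (hF : Continuous F) :
    IntegrableOn F (cube n) :=
  hF.continuousOn.integrableOn_compact (isCompact_cube n)

theorem piFinSuccAbove_zero_symm_apply {n : ℕ} (p : ℝ × (Fin n → ℝ)) :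
    (MeasurableEquiv.piFinSuccAbove (fun _ : Fin (n + 1) => ℝ) 0).symm p = Fin.cons p.1 p.2 := by
  ext i
  simp [MeasurableEquiv.piFinSuccAbove]

theorem setIntegral_cube_succ {n : ℕ} {F : (Fin (n + 1) → ℝ) → ℝ} (hF : IntegrableOn F (cube (n + 1))) :
    ∫ θ in cube (n + 1), F θ = ∫ τ in cube n, ∫ t in (-2 : ℝ)..2, F (Fin.cons t τ) := by
  have hmp := (volume_preserving_piFinSuccAbove (fun _ : Fin (n + 1) => ℝ) 0).symm
  have hpre : (MeasurableEquiv.piFinSuccAbove (fun _ : Fin (n + 1) => ℝ) 0).symm ⁻¹' cube (n + 1) =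
      Set.Icc (-2 : ℝ) 2 ×ˢ cube n := by
    ext p
    simp only [Set.mem_preimage, piFinSuccAbove_zero_symm_apply, mem_cube, Set.mem_prod, Set.mem_Icc, Fin.forall_fin_succ,
      Fin.cons_zero, Fin.cons_succ]
  have h := hmp.setIntegral_preimage_emb (MeasurableEquiv.measurableEmbedding _) F (cube (n + 1))
  have hI := (hmp.integrableOn_comp_preimage (MeasurableEquiv.measurableEmbedding _)
    (f := F) (s := cube (n + 1))).2 hF
  rw [hpre] at h hI
  simp only [piFinSuccAbove_zero_symm_apply] at h
  have hI' : IntegrableOn (fun p : ℝ × (Fin n → ℝ) => F (Fin.cons p.1 p.2))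
      (Set.Icc (-2 : ℝ) 2 ×ˢ cube n) (volume.prod volume) := by
    refine hI.congr_fun (fun p _ => by simp only [Function.comp, piFinSuccAbove_zero_symm_apply]) ?_
    exact measurableSet_Icc.prod (measurableSet_cube n)
  rw [← h]
  have := setIntegral_prod_swap (Set.Icc (-2 : ℝ) 2) (cube n)
    (fun p : ℝ × (Fin n → ℝ) => F (Fin.cons p.1 p.2)) (μ := volume) (ν := volume)
  erw [← this]
  erw [setIntegral_prod _ hI'.swap]
  refine integral_congr_ae (Filter.Eventually.of_forall fun τ => ?_)
  dsimp only [Function.comp, Prod.swap]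
  rw [intervalIntegral.integral_of_le (by norm_num), integral_Icc_eq_integral_Ioc]

end Selberg

section Selberg
open MeasureTheory

theorem abs_abs_div_self_le_one (x : ℝ) : |(|x| / x)| ≤ 1 := by
  rw [abs_div, abs_abs]; exact div_self_le_one _

theorem MeasureTheory.Integrable.mul_abs_div_self {α : Type*} [MeasurableSpace α] {μ : Measure α}
    {G x : α → ℝ} (hG : Integrable G μ) (hx : Measurable x) :
    Integrable (fun a => G a * (|x a| / x a)) μ := by
  refine hG.mono (hG.aestronglyMeasurable.mul ?_) (Filter.Eventually.of_forall fun a => ?_)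
  · exact ((measurable_norm.comp hx).div hx).aestronglyMeasurable
  · rw [norm_mul]
    exact mul_le_of_le_one_right (norm_nonneg _) (abs_abs_div_self_le_one _)

theorem vdmAbs_cons_div {n : ℕ} (t : ℝ) (τ : Fin n → ℝ) (j : Fin n) :
    vdmAbs (Fin.cons t τ : Fin (n + 1) → ℝ) / (t - τ j) =
      (∏ i ∈ Finset.univ.erase j, |t - τ i|) * vdmAbs τ * (|t - τ j| / (t - τ j)) := by
  rw [vdmAbs_cons, ← Finset.mul_prod_erase _ _ (Finset.mem_univ j)]
  ring

theorem hasDerivAt_vdmAbs_cons {n : ℕ} (τ : Fin n → ℝ) {t : ℝ} (ht : ∀ j, t ≠ τ j) :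
    HasDerivAt (fun t => vdmAbs (Fin.cons t τ : Fin (n + 1) → ℝ))
      (∑ j, vdmAbs (Fin.cons t τ : Fin (n + 1) → ℝ) / (t - τ j)) t := by
  have h : ∀ j ∈ (Finset.univ : Finset (Fin n)),
      HasDerivAt (fun t => |t - τ j|) (|t - τ j| / (t - τ j)) t := by
    intro j _
    have h0 : t - τ j ≠ 0 := sub_ne_zero.2 (ht j)
    refine ((hasDerivAt_abs h0).comp t ((hasDerivAt_id t).sub_const (τ j))).congr_deriv ?_
    rw [mul_one, eq_div_iff h0]
    exact sign_mul_self _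
  simp only [vdmAbs_cons_div]
  simp only [vdmAbs_cons]
  refine ((HasDerivAt.fun_finsetProd h).mul_const (vdmAbs τ)).congr_deriv ?_
  rw [Finset.sum_mul]
  refine Finset.sum_congr rfl fun j _ => ?_
  rw [smul_eq_mul]; ring

theorem integral_deriv_mul_vdmAbs_cons {n : ℕ} (τ : Fin n → ℝ) {p p' : ℝ → ℝ}
    (hp : ∀ t, HasDerivAt p (p' t) t) (hp' : Continuous p') :
    ∫ t in (-2 : ℝ)..2, (p' t * vdmAbs (Fin.cons t τ : Fin (n + 1) → ℝ) +
        ∑ j, p t * (vdmAbs (Fin.cons t τ : Fin (n + 1) → ℝ) / (t - τ j))) =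
      p 2 * vdmAbs (Fin.cons 2 τ : Fin (n + 1) → ℝ) -
        p (-2) * vdmAbs (Fin.cons (-2) τ : Fin (n + 1) → ℝ) := by
  have hpc : Continuous p := continuous_iff_continuousAt.2 fun t => (hp t).continuousAt
  have hV : Continuous fun t => vdmAbs (Fin.cons t τ : Fin (n + 1) → ℝ) := by
    simp only [vdmAbs_cons]; fun_prop
  refine integral_eq_of_hasDerivAt_off_countable_of_le
    (fun t => p t * vdmAbs (Fin.cons t τ : Fin (n + 1) → ℝ)) _ (by norm_num)
    (s := Set.range τ) (Set.countable_range τ) (hpc.mul hV).continuousOn ?_ ?_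
  · intro t ht
    refine ((hp t).mul (hasDerivAt_vdmAbs_cons τ (t := t) ?_)).congr_deriv ?_
    · rintro j rfl; exact ht.2 ⟨j, rfl⟩
    · rw [Finset.mul_sum]
  · refine IntervalIntegrable.add ((hp'.mul hV).intervalIntegrable _ _) ?_
    rw [← Finset.sum_fn]
    refine IntervalIntegrable.sum _ fun j _ => ?_
    simp only [vdmAbs_cons_div, ← mul_assoc]
    rw [intervalIntegrable_iff]
    refine Integrable.mul_abs_div_self (x := fun t => t - τ j) ?_ (by fun_prop)
    rw [← IntegrableOn, ← intervalIntegrable_iff]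
    exact Continuous.intervalIntegrable (by fun_prop) _ _

theorem integrableOn_mul_vdmAbs_div {n : ℕ} {F : (Fin (n + 1) → ℝ) → ℝ} (hF : Continuous F)
    (j : Fin n) :
    IntegrableOn (fun θ => F θ * (vdmAbs θ / (θ 0 - θ j.succ))) (cube (n + 1)) := by
  have h : ∀ θ : Fin (n + 1) → ℝ, F θ * (vdmAbs θ / (θ 0 - θ j.succ)) =
      F θ * ((∏ i ∈ Finset.univ.erase j, |θ 0 - θ i.succ|) * vdmAbs (Fin.tail θ)) *
        (|θ 0 - θ j.succ| / (θ 0 - θ j.succ)) := by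
    intro θ
    have := vdmAbs_cons_div (θ 0) (Fin.tail θ) j
    rw [Fin.cons_self_tail] at this
    rw [show θ j.succ = Fin.tail θ j from rfl, this]
    simp only [Fin.tail]; ring
  simp only [h]
  refine Integrable.mul_abs_div_self (x := fun θ : Fin (n + 1) → ℝ => θ 0 - θ j.succ) ?_
    (by fun_prop)
  refine integrableOn_cube_of_continuous (hF.mul (Continuous.mul (by fun_prop) ?_))
  exact (continuous_vdmAbs n).comp (by unfold Fin.tail; fun_prop)

theorem setIntegral_cube_deriv {n : ℕ} {p p' : ℝ → ℝ} {w : (Fin n → ℝ) → ℝ}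
    (hp : ∀ t, HasDerivAt p (p' t) t) (hp' : Continuous p') (hw : Continuous w) :
    (∫ θ in cube (n + 1), p' (θ 0) * w (Fin.tail θ) * vdmAbs θ) +
        ∑ j : Fin n, ∫ θ in cube (n + 1),
          p (θ 0) * w (Fin.tail θ) * (vdmAbs θ / (θ 0 - θ j.succ)) =
      ∫ τ in cube n, w τ * (p 2 * vdmAbs (Fin.cons 2 τ : Fin (n + 1) → ℝ) -
        p (-2) * vdmAbs (Fin.cons (-2) τ : Fin (n + 1) → ℝ)) := by
  have hpc : Continuous p := continuous_iff_continuousAt.2 fun t => (hp t).continuousAt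
  have ht : Continuous fun θ : Fin (n + 1) → ℝ => Fin.tail θ := by unfold Fin.tail; fun_prop
  have hI1 : IntegrableOn (fun θ : Fin (n + 1) → ℝ => p' (θ 0) * w (Fin.tail θ) * vdmAbs θ)
      (cube (n + 1)) := by
    refine integrableOn_cube_of_continuous ?_
    exact ((hp'.comp (continuous_apply 0)).mul (hw.comp ht)).mul (continuous_vdmAbs _)
  have hI2 : ∀ j : Fin n, IntegrableOn (fun θ : Fin (n + 1) → ℝ =>
      p (θ 0) * w (Fin.tail θ) * (vdmAbs θ / (θ 0 - θ j.succ))) (cube (n + 1)) := fun j =>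
    integrableOn_mul_vdmAbs_div ((hpc.comp (continuous_apply 0)).mul (hw.comp ht)) j
  rw [← integral_finsetSum _ fun j _ => hI2 j, ← integral_add hI1 (integrable_finsetSum _ fun j _ => hI2 j)]
  refine (setIntegral_cube_succ (hI1.add (integrable_finsetSum _ fun j _ => hI2 j))).trans ?_
  refine integral_congr_ae (Filter.Eventually.of_forall fun τ => ?_)
  dsimp only [Pi.add_apply]
  rw [← integral_deriv_mul_vdmAbs_cons τ hp hp', ← intervalIntegral.integral_const_mul]
  refine intervalIntegral.integral_congr fun t _ => ?_
  simp only [Fin.cons_zero, Fin.cons_succ, Fin.tail_cons, mul_add, Finset.mul_sum]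
  congr 1
  · ring
  · exact Finset.sum_congr rfl fun j _ => by ring

theorem setIntegral_cube_symmetrize {n : ℕ} {F G : (Fin n → ℝ) → ℝ} (σ : Equiv.Perm (Fin n))
    (hF : IntegrableOn F (cube n)) (h : ∀ θ, F θ + F (θ ∘ σ) = G θ) :
    ∫ θ in cube n, F θ = (∫ θ in cube n, G θ) / 2 := by
  have := setIntegral_cube_comp_perm σ F
  simp only [← h]
  rw [integral_add hF (hF.cube_comp_perm σ), this]
  ring

end Selberg

section Selberg
open MeasureTheory

/-- The integral of `∏ i ∈ s, (θ i + 2)` against the absolute value of the Vandermonde determinant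
over the cube `[-2, 2]ⁿ`. -/
noncomputable def vdmMoment {n : ℕ} (s : Finset (Fin n)) : ℝ :=
  ∫ θ in cube n, (∏ i ∈ s, (θ i + 2)) * vdmAbs θ

theorem integrableOn_vdmMoment {n : ℕ} (s : Finset (Fin n)) :
    IntegrableOn (fun θ => (∏ i ∈ s, (θ i + 2)) * vdmAbs θ) (cube n) :=
  integrableOn_cube_of_continuous (Continuous.mul (by fun_prop) (continuous_vdmAbs n))

theorem vdmMoment_eq_of_card_eq {n : ℕ} {s t : Finset (Fin n)} (h : s.card = t.card) :
    vdmMoment s = vdmMoment t := by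
  classical
  let σ : Equiv.Perm (Fin n) := (Finset.equivOfCardEq h).extendSubtype
  have hσ : s.map σ.toEmbedding = t := by
    refine Finset.eq_of_subset_of_card_le (fun y hy => ?_) (by simp [h])
    obtain ⟨x, hx, rfl⟩ := Finset.mem_map.1 hy
    exact (Finset.equivOfCardEq h).extendSubtype_mem x hx
  rw [vdmMoment, vdmMoment, ← setIntegral_cube_comp_perm σ fun θ => (∏ i ∈ s, (θ i + 2)) * vdmAbs θ, ← hσ]
  simp [vdmAbs_comp_perm]

theorem prod_tail_comp_swap {n : ℕ} {s : Finset (Fin n)} {j : Fin n} (hj : j ∉ s)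
    (θ : Fin (n + 1) → ℝ) :
    ∏ i ∈ s, ((θ ∘ Equiv.swap 0 j.succ) i.succ + 2) = ∏ i ∈ s, (θ i.succ + 2) := by
  refine Finset.prod_congr rfl fun i hi => ?_
  have hij : i ≠ j := fun h => hj (h ▸ hi)
  rw [Function.comp, Equiv.swap_apply_of_ne_of_ne (Fin.succ_ne_zero i)]
  simpa using hij

theorem integral_pair_of_notMem {n : ℕ} {s : Finset (Fin n)} {j : Fin n} (hj : j ∉ s) :
    ∫ θ in cube (n + 1), (4 - θ 0 ^ 2) * (∏ i ∈ s, (Fin.tail θ i + 2)) *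
        (vdmAbs θ / (θ 0 - θ j.succ)) =
      (4 * vdmMoment (s.map (Fin.succEmb n)) - vdmMoment (insert 0 (s.map (Fin.succEmb n))) -
        vdmMoment (insert j.succ (s.map (Fin.succEmb n)))) / 2 := by
  have h0 : (0 : Fin (n + 1)) ∉ s.map (Fin.succEmb n) := by simp
  have h1 : j.succ ∉ s.map (Fin.succEmb n) := by simpa using hj
  rw [vdmMoment, vdmMoment, vdmMoment, ← integral_const_mul, ← integral_sub, ← integral_sub]
  rotate_left
  · exact ((integrableOn_vdmMoment _).const_mul 4).sub (integrableOn_vdmMoment _)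
  · exact integrableOn_vdmMoment _
  · exact (integrableOn_vdmMoment _).const_mul 4
  · exact integrableOn_vdmMoment _
  refine setIntegral_cube_symmetrize (Equiv.swap 0 j.succ)
    (integrableOn_mul_vdmAbs_div (by unfold Fin.tail; fun_prop) j) fun θ => ?_
  simp only [Fin.tail, prod_tail_comp_swap hj, vdmAbs_comp_perm, Finset.prod_insert h0,
    Finset.prod_insert h1, Finset.prod_map, Fin.coe_succEmb]
  simp only [Function.comp, Equiv.swap_apply_left, Equiv.swap_apply_right]
  by_cases h : θ 0 = θ j.succ
  · simp [vdmAbs_eq_zero (Fin.succ_ne_zero j).symm h]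
  · have h2 : θ 0 - θ j.succ ≠ 0 := sub_ne_zero.2 h
    have h3 : θ j.succ - θ 0 ≠ 0 := sub_ne_zero.2 (Ne.symm h)
    rw [← neg_sub (θ 0) (θ j.succ)]
    field_simp
    ring

theorem integral_pair_of_mem {n : ℕ} {s : Finset (Fin n)} {j : Fin n} (hj : j ∈ s) :
    ∫ θ in cube (n + 1), (4 - θ 0 ^ 2) * (∏ i ∈ s, (Fin.tail θ i + 2)) *
        (vdmAbs θ / (θ 0 - θ j.succ)) =
      (- vdmMoment (insert 0 (s.map (Fin.succEmb n)))) / 2 := by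
  have h0 : (0 : Fin (n + 1)) ∉ s.map (Fin.succEmb n) := by simp
  rw [vdmMoment, ← integral_neg]
  refine setIntegral_cube_symmetrize (Equiv.swap 0 j.succ)
    (integrableOn_mul_vdmAbs_div (by unfold Fin.tail; fun_prop) j) fun θ => ?_
  simp only [Fin.tail, ← Finset.mul_prod_erase s _ hj, prod_tail_comp_swap (Finset.notMem_erase j s),
    vdmAbs_comp_perm, Finset.prod_insert h0, Finset.prod_map, Fin.coe_succEmb]
  simp only [Function.comp, Equiv.swap_apply_left, Equiv.swap_apply_right]
  by_cases h : θ 0 = θ j.succ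
  · simp [vdmAbs_eq_zero (Fin.succ_ne_zero j).symm h]
  · have h2 : θ 0 - θ j.succ ≠ 0 := sub_ne_zero.2 h
    rw [← neg_sub (θ 0) (θ j.succ)]
    field_simp
    ring

theorem integral_pair_boundary {n : ℕ} (j : Fin n) :
    ∫ θ in cube (n + 1), (2 - θ 0) * 1 * (vdmAbs θ / (θ 0 - θ j.succ)) =
      (- vdmMoment (∅ : Finset (Fin (n + 1)))) / 2 := by
  rw [vdmMoment, ← integral_neg]
  refine setIntegral_cube_symmetrize (Equiv.swap 0 j.succ)
    (integrableOn_mul_vdmAbs_div (by fun_prop) j) fun θ => ?_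
  simp only [vdmAbs_comp_perm, Finset.prod_empty, Function.comp, Equiv.swap_apply_left,
    Equiv.swap_apply_right]
  by_cases h : θ 0 = θ j.succ
  · simp [vdmAbs_eq_zero (Fin.succ_ne_zero j).symm h]
  · have h2 : θ 0 - θ j.succ ≠ 0 := sub_ne_zero.2 h
    rw [← neg_sub (θ 0) (θ j.succ)]
    field_simp
    ring

/-- `vdmMoment` over the first `c` coordinates. -/
noncomputable def initialVdmMoment (n c : ℕ) : ℝ :=
  vdmMoment (Finset.univ.filter fun i : Fin n => (i : ℕ) < c)

theorem vdmMoment_eq {n c : ℕ} {s : Finset (Fin n)} (h : s.card = c) :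
    vdmMoment s = initialVdmMoment n c := by
  have hc : c ≤ n := by simpa [h] using s.card_le_univ
  refine vdmMoment_eq_of_card_eq ?_
  rw [h, Fin.card_filter_val_lt, min_eq_right hc]

theorem initialVdmMoment_succ {n c : ℕ} (hc : c ≤ n) :
    initialVdmMoment (n + 1) c * (4 * (n + 2 - c)) =
      initialVdmMoment (n + 1) (c + 1) * (2 * n + 4 - c) := by
  classical
  obtain ⟨s, hs⟩ := Finset.exists_subset_card_eq (s := (Finset.univ : Finset (Fin n))) (n := c)
    (by simpa using hc)
  replace hs := hs.2
  have hA : vdmMoment (s.map (Fin.succEmb n)) = initialVdmMoment (n + 1) c :=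
    vdmMoment_eq (by simp [hs])
  have hB : vdmMoment (insert 0 (s.map (Fin.succEmb n))) = initialVdmMoment (n + 1) (c + 1) :=
    vdmMoment_eq (by rw [Finset.card_insert_of_notMem (by simp)]; simp [hs])
  have hD : ∀ j ∉ s, vdmMoment (insert j.succ (s.map (Fin.succEmb n))) =
      initialVdmMoment (n + 1) (c + 1) := fun j hj =>
    vdmMoment_eq (by rw [Finset.card_insert_of_notMem (by simpa using hj)]; simp [hs])
  have hmain := setIntegral_cube_deriv (n := n) (p := fun t => 4 - t ^ 2) (p' := fun t => -2 * t)
    (w := fun τ => ∏ i ∈ s, (τ i + 2))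
    (fun t => by simpa using (hasDerivAt_pow 2 t).const_sub 4) (by fun_prop) (by fun_prop)
  have hfirst : ∫ θ in cube (n + 1), -2 * θ 0 * (∏ i ∈ s, (Fin.tail θ i + 2)) * vdmAbs θ =
      4 * vdmMoment (s.map (Fin.succEmb n)) - 2 * vdmMoment (insert 0 (s.map (Fin.succEmb n))) := by
    rw [vdmMoment, vdmMoment, ← integral_const_mul, ← integral_const_mul, ← integral_sub]
    · refine integral_congr_ae (Filter.Eventually.of_forall fun θ => ?_)
      have h0 : (0 : Fin (n + 1)) ∉ s.map (Fin.succEmb n) := by simp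
      simp only [Fin.tail, Finset.prod_insert h0, Finset.prod_map, Fin.coe_succEmb]
      ring
    · exact (integrableOn_vdmMoment _).const_mul 4
    · exact (integrableOn_vdmMoment _).const_mul 2
  have hpair : ∀ j : Fin n, ∫ θ in cube (n + 1), (4 - θ 0 ^ 2) * (∏ i ∈ s, (Fin.tail θ i + 2)) *
      (vdmAbs θ / (θ 0 - θ j.succ)) = if j ∈ s then -initialVdmMoment (n + 1) (c + 1) / 2 else
        2 * initialVdmMoment (n + 1) c - initialVdmMoment (n + 1) (c + 1) := by
    intro j
    split_ifs with hj
    · rw [integral_pair_of_mem hj, hB]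
    · rw [integral_pair_of_notMem hj, hB, hA, hD j hj]; ring
  have hcard : (Finset.univ.filter fun j : Fin n => j ∉ s).card = n - c := by
    rw [Finset.filter_not, Finset.card_sdiff_of_subset (Finset.filter_subset _ _)]
    simp [hs]
  simp only [hpair, hfirst, hA, hB] at hmain
  rw [Finset.sum_ite, Finset.sum_const, Finset.sum_const, hcard, Finset.filter_univ_mem, hs] at hmain
  norm_num [Nat.cast_sub hc] at hmain
  linarith

theorem initialVdmMoment_zero_succ (n : ℕ) :
    initialVdmMoment (n + 1) 0 * (n + 2) = 8 * initialVdmMoment n n := by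
  have hmain := setIntegral_cube_deriv (n := n) (p := fun t => 2 - t) (p' := fun _ => -1)
    (w := fun _ => 1) (fun t => by simpa using (hasDerivAt_id t).const_sub 2)
    (by fun_prop) (by fun_prop)
  have hA : vdmMoment (∅ : Finset (Fin (n + 1))) = initialVdmMoment (n + 1) 0 :=
    vdmMoment_eq (by simp)
  have hB : vdmMoment (Finset.univ : Finset (Fin n)) = initialVdmMoment n n :=
    vdmMoment_eq (by simp)
  have hfirst : ∫ θ in cube (n + 1), (-1 : ℝ) * 1 * vdmAbs θ = -initialVdmMoment (n + 1) 0 := by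
    rw [← hA, vdmMoment, ← integral_neg]
    simp
  have hlast : ∫ τ in cube n, (1 : ℝ) * ((2 - 2) * vdmAbs (Fin.cons 2 τ : Fin (n + 1) → ℝ) -
      (2 - (-2)) * vdmAbs (Fin.cons (-2) τ : Fin (n + 1) → ℝ)) = -(4 * initialVdmMoment n n) := by
    rw [← hB, vdmMoment, ← integral_const_mul, ← integral_neg]
    refine setIntegral_congr_fun (measurableSet_cube n) fun τ hτ => ?_
    rw [mem_cube] at hτ
    simp only [vdmAbs_cons]
    have : ∏ j, |(-2 : ℝ) - τ j| = ∏ j, (τ j + 2) := by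
      refine Finset.prod_congr rfl fun j _ => ?_
      rw [abs_of_nonpos (by linarith [(hτ j).1])]; ring
    rw [this]; ring
  simp only [integral_pair_boundary, hfirst, hlast, hA] at hmain
  rw [Finset.sum_const, Finset.card_univ, Fintype.card_fin, nsmul_eq_mul] at hmain
  linarith

theorem initialVdmMoment_mul_factorial (n c : ℕ) (hc : c ≤ n) :
    initialVdmMoment n c * ((2 * n + 2).factorial * (n + 1 - c).factorial) =
      4 ^ c * ((n + 1).factorial * (2 * n + 2 - c).factorial) * initialVdmMoment n 0 := by
  obtain _ | n := n
  · obtain rfl : c = 0 := by omega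
    simp; ring
  induction c with
  | zero => simp; ring
  | succ c ih =>
    have h1 := ih (by omega)
    have h2 := initialVdmMoment_succ (n := n) (c := c) (by omega)
    obtain ⟨d, rfl⟩ : ∃ d, n = c + d := ⟨n - c, by omega⟩
    have e1 : (c + d + 1 + 1 - c).factorial = (d + 2) * (c + d + 1 + 1 - (c + 1)).factorial := by
      rw [show c + d + 1 + 1 - c = (d + 1) + 1 by omega, show c + d + 1 + 1 - (c + 1) = d + 1 by omega,
        Nat.factorial_succ]
    have e2 : (2 * (c + d + 1) + 2 - c).factorial =
        (c + 2 * d + 4) * (2 * (c + d + 1) + 2 - (c + 1)).factorial := by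
      rw [show 2 * (c + d + 1) + 2 - c = (c + 2 * d + 3) + 1 by omega,
        show 2 * (c + d + 1) + 2 - (c + 1) = c + 2 * d + 3 by omega, Nat.factorial_succ]
    rw [e1, e2] at h1
    generalize (c + d + 1 + 1 - (c + 1)).factorial = x at h1 ⊢
    generalize (2 * (c + d + 1) + 2 - (c + 1)).factorial = y at h1 ⊢
    push_cast at h1 h2
    have hpos : (0 : ℝ) < c + 2 * d + 4 := by positivity
    have hpos2 : (0 : ℝ) < d + 2 := by positivity
    refine mul_left_cancel₀ (mul_pos hpos hpos2).ne' ?_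
    rw [pow_succ]
    linear_combination 4 * (d + 2 : ℝ) * h1 -
      (d + 2 : ℝ) * ((2 * (c + d + 1) + 2).factorial * x) * h2

theorem integral_vdmAbs_cube (n : ℕ) :
    ∫ θ in cube n, vdmAbs θ = n.factorial * (2 ^ (n * (n + 1)) *
      ∏ k ∈ Finset.range n, (k.factorial : ℝ) ^ 2 / ((2 * k + 1).factorial : ℝ)) := by
  have hA : ∀ n, ∫ θ in cube n, vdmAbs θ = initialVdmMoment n 0 := by
    intro n
    rw [← vdmMoment_eq (s := ∅) (by simp), vdmMoment]
    simp
  rw [hA]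
  induction n with
  | zero =>
    rw [← hA, Finset.prod_range_zero]
    simp [vdmAbs, cube, Measure.real, Real.volume_Icc_pi]
  | succ n ih =>
    have h1 := initialVdmMoment_zero_succ n
    have h2 := initialVdmMoment_mul_factorial n n le_rfl
    rw [ih] at h2
    rw [Finset.prod_range_succ]
    set P := ∏ k ∈ Finset.range n, (k.factorial : ℝ) ^ 2 / ((2 * k + 1).factorial : ℝ)
    have e1 : (n + 1 - n).factorial = 1 := by simp
    have e2 : (2 * n + 2 - n) = n + 1 + 1 := by omega
    have e3 : (2 * n + 2).factorial = (2 * n + 2) * (2 * n + 1).factorial := Nat.factorial_succ _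
    rw [e1, e2, e3, Nat.factorial_succ (n + 1), Nat.factorial_succ n] at h2
    rw [Nat.factorial_succ n, show (n + 1) * (n + 1 + 1) = n * (n + 1) + 2 * n + 2 by ring, pow_add,
      pow_add, pow_mul 2 2 n]
    push_cast at h2 ⊢
    have hf : ((2 * n + 1).factorial : ℝ) ≠ 0 := by positivity
    have hn : (n + 1 : ℝ) ≠ 0 := by positivity
    have hn2 : (n + 2 : ℝ) ≠ 0 := by positivity
    norm_num at h2 ⊢
    field_simp
    refine mul_left_cancel₀ hn (mul_left_cancel₀ hn2 (mul_left_cancel₀ (two_ne_zero (α := ℝ)) ?_))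
    linear_combination 2 * (n + 1 : ℝ) * ((2 * n + 1).factorial : ℝ) * h1 + 8 * h2

end Selberg

section Volume
open MeasureTheory

/-- The decreasing tuples with first entry in `(2, B]` and the others in `(-2, 2)`. -/
def rootRegion (m : ℕ) (B : ℝ) : Set (Fin (m + 1) → ℝ) :=
  {θ | StrictAnti θ ∧ (2 < θ 0 ∧ θ 0 ≤ B) ∧ ∀ i : Fin m, -2 < θ i.succ ∧ θ i.succ < 2}

/-- The coefficient vectors of the monic polynomials of degree `m + 1` with one root in `(2, B]` and
`m` distinct roots in `(-2, 2)`. -/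
def coeffRegion (m : ℕ) (B : ℝ) : Set (Fin (m + 1) → ℝ) := rootCoeff '' rootRegion m B

theorem measurableSet_strictAnti (n : ℕ) : MeasurableSet {θ : Fin n → ℝ | StrictAnti θ} := by
  have : {θ : Fin n → ℝ | StrictAnti θ} = ⋂ i, ⋂ j, ⋂ _ : i < j, {θ | θ j < θ i} := by
    ext θ; simp [StrictAnti]
  rw [this]
  refine MeasurableSet.iInter fun i => MeasurableSet.iInter fun j => MeasurableSet.iInter fun _ => ?_
  exact measurableSet_lt (measurable_pi_apply j) (measurable_pi_apply i)

/-- The decreasing tuples with entries in `(-2, 2)`. -/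
def orderedCube (m : ℕ) : Set (Fin m → ℝ) :=
  (Set.univ.pi fun _ => Set.Ioo (-2) 2) ∩ {τ | StrictAnti τ}

theorem measurableSet_orderedCube (m : ℕ) : MeasurableSet (orderedCube m) :=
  (MeasurableSet.univ_pi fun _ => measurableSet_Ioo).inter (measurableSet_strictAnti m)

theorem cons_mem_rootRegion {m : ℕ} {B β : ℝ} {τ : Fin m → ℝ} :
    (Fin.cons β τ : Fin (m + 1) → ℝ) ∈ rootRegion m B ↔ β ∈ Set.Ioc 2 B ∧ τ ∈ orderedCube m := by
  simp only [rootRegion, orderedCube, Set.mem_ofPred_eq, Fin.cons_zero, Fin.cons_succ, Set.mem_Ioc,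
    Set.mem_inter_iff, Set.mem_univ_pi, Set.mem_Ioo]
  constructor
  · rintro ⟨h1, h2, h3⟩
    refine ⟨h2, h3, fun i j hij => ?_⟩
    simpa using h1 (Fin.succ_lt_succ_iff.2 hij)
  · rintro ⟨h2, h3, h1⟩
    refine ⟨fun i j hij => ?_, h2, h3⟩
    obtain ⟨j, rfl⟩ := Fin.exists_succ_eq.2 (Fin.pos_iff_ne_zero.1 (lt_of_le_of_lt (Fin.zero_le i) hij))
    induction i using Fin.cases with
    | zero => simp only [Fin.cons_zero, Fin.cons_succ]; linarith [(h3 j).2]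
    | succ i => simpa using h1 (Fin.succ_lt_succ_iff.1 hij)

theorem piFinSuccAbove_symm_preimage_rootRegion (m : ℕ) (B : ℝ) :
    (MeasurableEquiv.piFinSuccAbove (fun _ : Fin (m + 1) => ℝ) 0).symm ⁻¹' rootRegion m B =
      Set.Ioc 2 B ×ˢ orderedCube m := by
  ext p
  rw [Set.mem_preimage, piFinSuccAbove_zero_symm_apply, cons_mem_rootRegion, Set.mem_prod]

theorem measurableSet_rootRegion (m : ℕ) (B : ℝ) : MeasurableSet (rootRegion m B) := by
  rw [← MeasurableEquiv.measurableSet_preimage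
    (MeasurableEquiv.piFinSuccAbove (fun _ : Fin (m + 1) => ℝ) 0).symm,
    piFinSuccAbove_symm_preimage_rootRegion]
  exact measurableSet_Ioc.prod (measurableSet_orderedCube m)

theorem rootRegion_subset_Icc (m : ℕ) (B : ℝ) :
    rootRegion m B ⊆ Set.Icc (fun _ => -2) (fun _ => max 2 B) := by
  rintro θ ⟨-, h1, h2⟩
  constructor <;> intro i <;> refine Fin.cases ?_ (fun i => ?_) i
  · simp only; linarith
  · exact (h2 i).1.le
  · exact h1.2.trans (le_max_right _ _)
  · exact (h2 i).2.le.trans (le_max_left _ _)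

theorem measurableSet_coeffRegion (m : ℕ) (B : ℝ) : MeasurableSet (coeffRegion m B) :=
  measurable_image_of_fderivWithin (measurableSet_rootRegion m B)
    (fun θ _ => (hasStrictFDerivAt_rootCoeff θ).hasFDerivAt.hasFDerivWithinAt)
    ((injOn_rootCoeff _).mono fun _ h => h.1)

theorem integrableOn_vdmAbs_rootRegion (m : ℕ) (B : ℝ) :
    IntegrableOn vdmAbs (rootRegion m B) :=
  ((continuous_vdmAbs _).continuousOn.integrableOn_compact isCompact_Icc).mono_set
    (rootRegion_subset_Icc m B)

theorem volume_coeffRegion (m : ℕ) (B : ℝ) :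
    volume (coeffRegion m B) = ENNReal.ofReal (∫ θ in rootRegion m B, vdmAbs θ) := by
  rw [coeffRegion, ← lintegral_abs_det_fderiv_eq_addHaar_image volume (measurableSet_rootRegion m B)
    (fun θ _ => (hasStrictFDerivAt_rootCoeff θ).hasFDerivAt.hasFDerivWithinAt)
    ((injOn_rootCoeff _).mono fun _ h => h.1),
    ofReal_integral_eq_lintegral_ofReal (integrableOn_vdmAbs_rootRegion m B)
      (Filter.Eventually.of_forall vdmAbs_nonneg)]
  refine setLIntegral_congr_fun (measurableSet_rootRegion m B) fun θ hθ => ?_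
  rw [abs_det_rootCoeffDeriv hθ.1.injective]

theorem sum_perm_strictAnti_indicator {n : ℕ} {F : (Fin n → ℝ) → ℝ}
    (hF : ∀ τ, ¬ Function.Injective τ → F τ = 0) (τ : Fin n → ℝ) :
    ∑ σ : Equiv.Perm (Fin n), Set.indicator {ρ : Fin n → ℝ | StrictAnti (ρ ∘ σ)} F τ = F τ := by
  classical
  by_cases hτ : Function.Injective τ
  · have hneg : Function.Injective (-τ) := neg_injective.comp hτ
    have hex : StrictAnti (τ ∘ Tuple.sort (-τ)) := by
      have h1 : StrictMono ((-τ) ∘ Tuple.sort (-τ)) :=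
        (Tuple.monotone_sort (-τ)).strictMono_of_injective (hneg.comp (Equiv.injective _))
      intro i j hij
      have := h1 hij
      simpa using this
    rw [Finset.sum_eq_single (Tuple.sort (-τ))]
    · rw [Set.indicator_of_mem]; exact hex
    · intro σ _ hσ
      refine Set.indicator_of_notMem (fun h => hσ ?_) _
      have h2 : τ ∘ σ = τ ∘ Tuple.sort (-τ) := by
        refine (StrictAnti.range_inj h hex).1 ?_
        rw [Set.range_comp, Set.range_comp, Equiv.range_eq_univ, Equiv.range_eq_univ]
      ext1 i
      exact hτ (congrFun h2 i)
    · simp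
  · rw [hF τ hτ]
    refine Finset.sum_eq_zero fun σ _ => ?_
    by_cases h : τ ∈ {ρ : Fin n → ℝ | StrictAnti (ρ ∘ σ)}
    · rw [Set.indicator_of_mem h, hF τ hτ]
    · exact Set.indicator_of_notMem h _

theorem setIntegral_orderedCube {n : ℕ} {F : (Fin n → ℝ) → ℝ} (hc : Continuous F)
    (hF : ∀ τ, ¬ Function.Injective τ → F τ = 0)
    (hs : ∀ (σ : Equiv.Perm (Fin n)) τ, F (τ ∘ σ) = F τ) :
    ∫ τ in orderedCube n, F τ = (∫ τ in cube n, F τ) / n.factorial := by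
  have hcube : (Set.univ.pi fun _ : Fin n => Set.Ioo (-2 : ℝ) 2) =ᵐ[volume] cube n := by
    rw [cube, Set.pi_univ_Icc, volume_pi]
    exact Measure.univ_pi_Ioo_ae_eq_Icc
  have hA := measurableSet_strictAnti n
  have hI : IntegrableOn (Set.indicator {τ : Fin n → ℝ | StrictAnti τ} F) (cube n) :=
    (integrableOn_cube_of_continuous hc).indicator hA
  have h1 : ∫ τ in orderedCube n, F τ =
      ∫ τ in cube n, Set.indicator {τ : Fin n → ℝ | StrictAnti τ} F τ := by
    rw [← setIntegral_congr_set hcube, setIntegral_indicator hA, orderedCube]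
  have hσ : ∀ σ : Equiv.Perm (Fin n), ∀ τ : Fin n → ℝ,
      Set.indicator {ρ : Fin n → ℝ | StrictAnti (ρ ∘ σ)} F τ =
      Set.indicator {τ : Fin n → ℝ | StrictAnti τ} F (τ ∘ σ) := by
    intro σ τ
    by_cases h : StrictAnti (τ ∘ σ)
    · rw [Set.indicator_of_mem (by exact h), Set.indicator_of_mem (by exact h), hs]
    · rw [Set.indicator_of_notMem (by exact h), Set.indicator_of_notMem (by exact h)]
  have h2 : ∫ τ in cube n, F τ = ∑ _σ : Equiv.Perm (Fin n), ∫ τ in orderedCube n, F τ := by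
    rw [h1, ← Finset.sum_congr rfl fun σ _ => setIntegral_cube_comp_perm σ _,
      ← integral_finsetSum _ fun σ _ => hI.cube_comp_perm σ]
    refine integral_congr_ae (Filter.Eventually.of_forall fun τ => ?_)
    simp only [← hσ]
    exact (sum_perm_strictAnti_indicator hF τ).symm
  rw [h2, Finset.sum_const, Finset.card_univ, Fintype.card_perm, Fintype.card_fin, nsmul_eq_mul,
    mul_div_cancel_left₀]
  exact_mod_cast n.factorial_ne_zero

theorem integrableOn_vdmAbs_cons_prod (m : ℕ) (B : ℝ) :
    IntegrableOn (fun p : ℝ × (Fin m → ℝ) => vdmAbs (Fin.cons p.1 p.2 : Fin (m + 1) → ℝ))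
      (Set.Ioc 2 B ×ˢ orderedCube m) (volume.prod volume) := by
  have h := ((volume_preserving_piFinSuccAbove (fun _ : Fin (m + 1) => ℝ) 0).symm
    ).integrableOn_comp_preimage (MeasurableEquiv.measurableEmbedding _)
      (f := vdmAbs) (s := rootRegion m B)
  rw [piFinSuccAbove_symm_preimage_rootRegion] at h
  refine (h.2 (integrableOn_vdmAbs_rootRegion m B)).congr_fun
    (fun p _ => by simp only [Function.comp, piFinSuccAbove_zero_symm_apply]) ?_
  exact measurableSet_Ioc.prod (measurableSet_orderedCube m)

theorem setIntegral_rootRegion (m : ℕ) (B : ℝ) :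
    ∫ θ in rootRegion m B, vdmAbs θ =
      ∫ β in Set.Ioc 2 B, ∫ τ in orderedCube m, vdmAbs (Fin.cons β τ : Fin (m + 1) → ℝ) := by
  have h := ((volume_preserving_piFinSuccAbove (fun _ : Fin (m + 1) => ℝ) 0).symm
    ).setIntegral_preimage_emb (MeasurableEquiv.measurableEmbedding _) vdmAbs (rootRegion m B)
  rw [piFinSuccAbove_symm_preimage_rootRegion] at h
  simp only [piFinSuccAbove_zero_symm_apply] at h
  rw [← h]
  exact setIntegral_prod _ (integrableOn_vdmAbs_cons_prod m B)

theorem abs_prod_sub_sub_pow_le {n : ℕ} {τ : Fin n → ℝ} (hτ : ∀ i, |τ i| ≤ 2) {β : ℝ} (hβ : 2 ≤ β) :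
    β * |∏ i, (β - τ i) - β ^ n| ≤ 4 ^ n * β ^ n := by
  have hb : ∀ i, |β - τ i| ≤ 2 * β := fun i => by
    have := abs_le.1 (hτ i); rw [abs_le]; constructor <;> linarith
  induction n with
  | zero => simp
  | succ n ih =>
    rw [Fin.prod_univ_succ]
    set P := ∏ i : Fin n, (β - τ i.succ) with hP
    have h1 : β * |P - β ^ n| ≤ 4 ^ n * β ^ n := ih (fun i => hτ i.succ) fun i => hb i.succ
    have h2 : |P| ≤ (2 * β) ^ n := by
      rw [hP, Finset.abs_prod]
      refine (Finset.prod_le_prod (fun _ _ => abs_nonneg _) fun (i : Fin n) _ =>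
        hb i.succ).trans_eq (by simp)
    have h3 : |(β - τ 0) * P - β ^ (n + 1)| ≤ β * |P - β ^ n| + 2 * (2 * β) ^ n := by
      have : (β - τ 0) * P - β ^ (n + 1) = β * (P - β ^ n) - τ 0 * P := by ring
      rw [this]
      refine (abs_sub _ _).trans ?_
      rw [abs_mul, abs_mul, abs_of_nonneg (by linarith : 0 ≤ β)]
      gcongr
      exact hτ 0
    have h4 : (2 : ℝ) ^ n ≤ 4 ^ n := pow_le_pow_left₀ (by norm_num) (by norm_num) n
    have h6 : (0 : ℝ) ≤ 4 ^ n := by positivity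
    have h5 : 0 ≤ β ^ n := by positivity
    calc β * |(β - τ 0) * P - β ^ (n + 1)| ≤ β * (4 ^ n * β ^ n + 2 * (2 * β) ^ n) := by
          gcongr; linarith
      _ = (4 ^ n + 2 * 2 ^ n) * (β * β ^ n) := by rw [mul_pow]; ring
      _ ≤ (4 ^ n * 4) * (β * β ^ n) := by gcongr; linarith
      _ = 4 ^ (n + 1) * β ^ (n + 1) := by ring

theorem setIntegral_orderedCube_vdmAbs_cons (m : ℕ) {β : ℝ} (hβ : 2 ≤ β) :
    ∫ τ in orderedCube m, vdmAbs (Fin.cons β τ : Fin (m + 1) → ℝ) =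
      (∫ τ in cube m, (∏ i, (β - τ i)) * vdmAbs τ) / m.factorial := by
  rw [← setIntegral_orderedCube]
  · refine setIntegral_congr_fun (measurableSet_orderedCube m) fun τ hτ => ?_
    simp only [vdmAbs_cons]
    congr 1
    refine Finset.prod_congr rfl fun i _ => abs_of_nonneg ?_
    linarith [(hτ.1 i trivial).2]
  · exact Continuous.mul (by fun_prop) (continuous_vdmAbs m)
  · intro τ hτ
    have : vdmAbs τ = 0 := by
      rw [vdmAbs, abs_eq_zero]; by_contra h0
      exact hτ (Matrix.det_vandermonde_ne_zero_iff.1 h0)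
    rw [this, mul_zero]
  · intro σ τ
    rw [vdmAbs_comp_perm]
    congr 1
    exact Equiv.prod_comp σ fun i => β - τ i

theorem abs_setIntegral_orderedCube_vdmAbs_cons_sub_le {m : ℕ} (hm : 1 ≤ m) {β : ℝ} (hβ : 2 ≤ β) :
    |(∫ τ in orderedCube m, vdmAbs (Fin.cons β τ : Fin (m + 1) → ℝ)) -
        salemOmega m * ((m + 1) * β ^ m)| ≤ 4 ^ m * (salemOmega m * (m + 1)) * β ^ (m - 1) := by
  have hβ0 : 0 < β := by linarith
  have hm0 : (m + 1 : ℝ) ≠ 0 := by positivity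
  have hf : (0 : ℝ) < m.factorial := by positivity
  have hK : ∫ τ in cube m, vdmAbs τ = salemOmega m * (m + 1) * m.factorial := by
    rw [integral_vdmAbs_cube, salemOmega]; field_simp
  have hsub : (∫ τ in cube m, (∏ i, (β - τ i)) * vdmAbs τ) - β ^ m * ∫ τ in cube m, vdmAbs τ =
      ∫ τ in cube m, ((∏ i, (β - τ i)) - β ^ m) * vdmAbs τ := by
    rw [← integral_const_mul, ← integral_sub]
    · simp only [sub_mul]
    · exact integrableOn_cube_of_continuous (Continuous.mul (by fun_prop) (continuous_vdmAbs m))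
    · exact integrableOn_cube_of_continuous (Continuous.mul (by fun_prop) (continuous_vdmAbs m))
  have hbound : |(∫ τ in cube m, (∏ i, (β - τ i)) * vdmAbs τ) - β ^ m * ∫ τ in cube m, vdmAbs τ| ≤
      4 ^ m * β ^ (m - 1) * ∫ τ in cube m, vdmAbs τ := by
    rw [hsub, ← integral_const_mul, ← Real.norm_eq_abs]
    refine norm_integral_le_of_norm_le
      ((integrableOn_cube_of_continuous (continuous_vdmAbs m)).const_mul _) ?_
    refine (ae_restrict_iff' (measurableSet_cube m)).2 (Filter.Eventually.of_forall fun τ hτ => ?_)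
    rw [norm_mul, Real.norm_eq_abs, Real.norm_eq_abs, abs_of_nonneg (vdmAbs_nonneg τ)]
    refine mul_le_mul_of_nonneg_right ?_ (vdmAbs_nonneg τ)
    have h := abs_prod_sub_sub_pow_le (τ := τ) (fun i => abs_le.2 (mem_cube.1 hτ i)) hβ
    refine le_of_mul_le_mul_left (h.trans_eq ?_) hβ0
    obtain ⟨k, rfl⟩ := Nat.exists_eq_add_of_le' hm
    simp only [Nat.add_sub_cancel]; ring
  rw [setIntegral_orderedCube_vdmAbs_cons m hβ]
  rw [hK] at hbound
  have : (∫ τ in cube m, (∏ i, (β - τ i)) * vdmAbs τ) / m.factorial -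
      salemOmega m * ((m + 1) * β ^ m) = ((∫ τ in cube m, (∏ i, (β - τ i)) * vdmAbs τ) -
        β ^ m * (salemOmega m * (m + 1) * m.factorial)) / m.factorial := by
    field_simp
  rw [this, abs_div, abs_of_pos hf, div_le_iff₀ hf]
  exact hbound.trans_eq (by ring)

theorem abs_volume_coeffRegion_sub_le {m : ℕ} (hm : 1 ≤ m) :
    ∃ C : ℝ, ∀ B : ℝ, 2 ≤ B →
      |(volume (coeffRegion m B)).toReal - salemOmega m * B ^ (m + 1)| ≤ C * B ^ m := by
  set c := 4 ^ m * (salemOmega m * (m + 1)) with hc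
  have hω : 0 ≤ salemOmega m := by unfold salemOmega; positivity
  refine ⟨c + salemOmega m * 2 ^ (m + 1), fun B hB => ?_⟩
  have hm0 : (m + 1 : ℝ) ≠ 0 := by positivity
  have hI : IntervalIntegrable
      (fun β => ∫ τ in orderedCube m, vdmAbs (Fin.cons β τ : Fin (m + 1) → ℝ)) volume 2 B := by
    rw [intervalIntegrable_iff_integrableOn_Ioc_of_le hB]
    have := integrableOn_vdmAbs_cons_prod m B
    rw [IntegrableOn, ← Measure.prod_restrict] at this
    exact this.integral_prod_left
  have hvol : (volume (coeffRegion m B)).toReal =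
      ∫ β in (2 : ℝ)..B, ∫ τ in orderedCube m, vdmAbs (Fin.cons β τ : Fin (m + 1) → ℝ) := by
    rw [volume_coeffRegion, ENNReal.toReal_ofReal (integral_nonneg vdmAbs_nonneg),
      setIntegral_rootRegion, intervalIntegral.integral_of_le hB]
  have hpow : ∫ β in (2 : ℝ)..B, salemOmega m * ((m + 1) * β ^ m) =
      salemOmega m * (B ^ (m + 1) - 2 ^ (m + 1)) := by
    rw [intervalIntegral.integral_const_mul, intervalIntegral.integral_const_mul, integral_pow]
    field_simp
  have hest : |(volume (coeffRegion m B)).toReal - salemOmega m * (B ^ (m + 1) - 2 ^ (m + 1))| ≤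
      c * B ^ (m - 1) * |B - 2| := by
    rw [hvol, ← hpow, ← intervalIntegral.integral_sub hI
      (Continuous.intervalIntegrable (by fun_prop) _ _), ← Real.norm_eq_abs]
    refine intervalIntegral.norm_integral_le_of_norm_le_const fun β hβ => ?_
    rw [Set.uIoc_of_le hB] at hβ
    refine (abs_setIntegral_orderedCube_vdmAbs_cons_sub_le hm hβ.1.le).trans ?_
    rw [← hc]
    have : 0 ≤ c := by positivity
    have : 0 ≤ β := by linarith [hβ.1]
    gcongr
    exact hβ.2
  have hBm : c * B ^ (m - 1) * |B - 2| ≤ c * B ^ m := by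
    obtain ⟨k, rfl⟩ := Nat.exists_eq_add_of_le' hm
    rw [abs_of_nonneg (by linarith), Nat.add_sub_cancel, pow_succ, mul_assoc]
    gcongr
    linarith
  have h1 : salemOmega m * 2 ^ (m + 1) ≤ salemOmega m * 2 ^ (m + 1) * B ^ m :=
    le_mul_of_one_le_right (by positivity) (one_le_pow₀ (by linarith))
  have h2 : 0 ≤ salemOmega m * 2 ^ (m + 1) := by positivity
  rw [abs_le] at hest ⊢
  constructor <;> nlinarith [hest.1, hest.2]

end Volume

section LatticePoints
open MeasureTheory

theorem IsPreconnected.subset_or_disjoint_of_disjoint_frontier {X : Type*} [TopologicalSpace X]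
    {s t : Set X} (ht : IsPreconnected t) (h : Disjoint t (frontier s)) : t ⊆ s ∨ Disjoint t s := by
  by_contra! hc
  obtain ⟨h1, h2⟩ := hc
  obtain ⟨x, hxt, hxs⟩ := Set.not_subset.1 h1
  obtain ⟨y, hyt, hys⟩ := Set.not_disjoint_iff.1 h2
  have hcover : t ⊆ interior s ∪ (closure s)ᶜ := by
    intro z hz
    by_cases hzi : z ∈ interior s
    · exact Or.inl hzi
    · exact Or.inr fun hzc => Set.disjoint_left.1 h hz ⟨hzc, hzi⟩
  have hy : y ∈ interior s := (hcover hyt).resolve_right fun hc => hc (subset_closure hys)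
  have hx : x ∈ (closure s)ᶜ := (hcover hxt).resolve_left fun hc => hxs (interior_subset hc)
  obtain ⟨z, -, hz1, hz2⟩ := ht _ _ isOpen_interior isClosed_closure.isOpen_compl hcover
    ⟨y, hyt, hy⟩ ⟨x, hxt, hx⟩
  exact hz2 (subset_closure (interior_subset hz1))

/-- The vector of integer parts. -/
noncomputable def floorVec {n : ℕ} (x : Fin n → ℝ) : Fin n → ℤ := fun i => ⌊x i⌋

theorem floorVec_preimage_singleton {n : ℕ} (z : Fin n → ℤ) :
    floorVec ⁻¹' {z} = Set.univ.pi fun i => Set.Ico (z i : ℝ) (z i + 1) := by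
  ext x
  simp [floorVec, funext_iff, Int.floor_eq_iff]

theorem floorVec_intCast {n : ℕ} (z : Fin n → ℤ) : floorVec (fun i => (z i : ℝ)) = z := by
  ext i; simp [floorVec]

theorem volume_floorVec_preimage_singleton {n : ℕ} (z : Fin n → ℤ) :
    volume (floorVec ⁻¹' {z}) = 1 := by
  rw [floorVec_preimage_singleton, Real.volume_pi_Ico]; simp

theorem measurableSet_floorVec_preimage_singleton {n : ℕ} (z : Fin n → ℤ) :
    MeasurableSet (floorVec ⁻¹' {z}) := by
  rw [floorVec_preimage_singleton]; exact MeasurableSet.univ_pi fun _ => measurableSet_Ico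

theorem abs_ite_sub_measureReal_inter_le {n : ℕ} (S : Set (Fin n → ℝ)) (z : Fin n → ℤ)
    [Decidable ((fun i => (z i : ℝ)) ∈ S)] :
    |(if (fun i => (z i : ℝ)) ∈ S then (1 : ℝ) else 0) - volume.real (S ∩ floorVec ⁻¹' {z})| ≤ 1 := by
  have h1 : volume.real (S ∩ floorVec ⁻¹' {z}) ≤ 1 := by
    rw [Measure.real, ← ENNReal.toReal_one, ← volume_floorVec_preimage_singleton z]
    refine ENNReal.toReal_mono ?_ (measure_mono Set.inter_subset_right)
    rw [volume_floorVec_preimage_singleton]; simp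
  have h2 : 0 ≤ volume.real (S ∩ floorVec ⁻¹' {z}) := measureReal_nonneg
  rw [abs_le]
  split_ifs <;> constructor <;> linarith

theorem ite_sub_measureReal_inter_eq_zero {n : ℕ} {S : Set (Fin n → ℝ)} {z : Fin n → ℤ}
    [Decidable ((fun i => (z i : ℝ)) ∈ S)] (h : Disjoint (floorVec ⁻¹' {z}) (frontier S)) :
    (if (fun i => (z i : ℝ)) ∈ S then (1 : ℝ) else 0) - volume.real (S ∩ floorVec ⁻¹' {z}) = 0 := by
  have hz : (fun i => (z i : ℝ)) ∈ floorVec ⁻¹' {z} := floorVec_intCast z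
  have hpre : IsPreconnected (floorVec ⁻¹' {z}) := by
    rw [floorVec_preimage_singleton]
    exact (convex_pi fun i _ => convex_Ico _ _).isPreconnected
  rcases hpre.subset_or_disjoint_of_disjoint_frontier h with h | h
  · rw [if_pos (h hz), Set.inter_eq_right.2 h, Measure.real, volume_floorVec_preimage_singleton]
    simp
  · rw [if_neg (Set.disjoint_left.1 h hz), Set.inter_comm, Set.disjoint_iff_inter_eq_empty.1 h]
    simp

theorem finite_intCast_mem {n : ℕ} {S : Set (Fin n → ℝ)} (hb : Bornology.IsBounded S) :
    (floorVec '' S).Finite := by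
  obtain ⟨R, hR⟩ := hb.exists_norm_le
  refine (Fintype.piFinset fun _ : Fin n => Finset.Icc (⌊-R⌋) ⌊R⌋).finite_toSet.subset ?_
  rintro _ ⟨x, hx, rfl⟩
  simp only [Finset.mem_coe, Fintype.mem_piFinset, Finset.mem_Icc, floorVec]
  intro i
  have := abs_le.1 ((norm_le_pi_norm x i).trans (hR x hx))
  exact ⟨Int.floor_le_floor this.1, Int.floor_le_floor this.2⟩

/-- The number of integer points of a bounded set differs from its volume by at most the number of
unit cells that meet its frontier. -/
theorem abs_ncard_sub_volume_le {n : ℕ} {S : Set (Fin n → ℝ)} (hb : Bornology.IsBounded S)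
    (hS : MeasurableSet S) {T : Finset (Fin n → ℤ)} (hT : ∀ x ∈ frontier S, floorVec x ∈ T) :
    |({z : Fin n → ℤ | (fun i => (z i : ℝ)) ∈ S}.ncard : ℝ) - (volume S).toReal| ≤ T.card := by
  classical
  set W := (finite_intCast_mem hb).toFinset with hW
  have hmemW : ∀ x ∈ S, floorVec x ∈ W := fun x hx => by
    rw [hW, Set.Finite.mem_toFinset]; exact ⟨x, hx, rfl⟩
  have hcount : ({z : Fin n → ℤ | (fun i => (z i : ℝ)) ∈ S}.ncard : ℝ) =
      ∑ z ∈ W, if (fun i => (z i : ℝ)) ∈ S then (1 : ℝ) else 0 := by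
    have : {z : Fin n → ℤ | (fun i => (z i : ℝ)) ∈ S} =
        ((W.filter fun z => (fun i => (z i : ℝ)) ∈ S : Finset (Fin n → ℤ)) : Set (Fin n → ℤ)) := by
      ext z
      simp only [Set.mem_ofPred_eq, Finset.coe_filter]
      refine ⟨fun h => ⟨?_, h⟩, fun h => h.2⟩
      rw [← floorVec_intCast z]; exact hmemW _ h
    rw [this, Set.ncard_coe_finset, Finset.card_filter]
    push_cast; rfl
  have hvol : (volume S).toReal = ∑ z ∈ W, volume.real (S ∩ floorVec ⁻¹' {z}) := by
    have hunion : S = ⋃ z ∈ W, S ∩ floorVec ⁻¹' {z} := by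
      ext x
      simp only [Set.mem_iUnion, Set.mem_inter_iff, Set.mem_preimage, Set.mem_singleton_iff]
      exact ⟨fun h => ⟨_, hmemW x h, h, rfl⟩, fun ⟨_, _, h, _⟩ => h⟩
    rw [← measureReal_biUnion_finset (h := fun z _ => ?_), ← hunion, Measure.real]
    · intro z _ w _ hzw
      refine Set.disjoint_left.2 fun x hx hy => hzw ?_
      exact (hx.2 : floorVec x = z).symm.trans hy.2
    · exact fun z _ => hS.inter (measurableSet_floorVec_preimage_singleton z)
    · refine ((measure_mono Set.inter_subset_right).trans_lt ?_).ne
      rw [volume_floorVec_preimage_singleton]; exact ENNReal.one_lt_top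
  rw [hcount, hvol, ← Finset.sum_sub_distrib]
  refine (Finset.abs_sum_le_sum_abs _ _).trans ?_
  calc ∑ z ∈ W, |(if (fun i => (z i : ℝ)) ∈ S then (1 : ℝ) else 0) -
        volume.real (S ∩ floorVec ⁻¹' {z})| ≤ ∑ z ∈ W, if z ∈ T then (1 : ℝ) else 0 := by
        refine Finset.sum_le_sum fun z _ => ?_
        by_cases hz : z ∈ T
        · rw [if_pos hz]; exact abs_ite_sub_measureReal_inter_le S z
        · rw [if_neg hz, ite_sub_measureReal_inter_eq_zero, abs_zero]
          refine Set.disjoint_left.2 fun x hx hxf => hz ?_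
          rw [← (hx : floorVec x = z)]; exact hT x hxf
    _ = ((W.filter (· ∈ T)).card : ℝ) := by rw [Finset.card_filter]; push_cast; rfl
    _ ≤ T.card := by
        exact_mod_cast Finset.card_le_card fun z hz => (Finset.mem_filter.1 hz).2

/-- If `f` varies boundedly on the fibres of `g`, then `f` takes boundedly many more values
than `g`. -/
theorem exists_finset_image_subset_of_fiberwise {X ι : Type*} {n : ℕ} {P : Set X}
    {f : X → Fin n → ℤ} {g : X → ι} {G : Finset ι} {L : ℕ} (hg : ∀ x ∈ P, g x ∈ G)
    (hf : ∀ x ∈ P, ∀ y ∈ P, g x = g y → ∀ k, |f x k - f y k| ≤ L) :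
    ∃ T : Finset (Fin n → ℤ), (∀ x ∈ P, f x ∈ T) ∧ T.card ≤ G.card * (2 * L + 1) ^ n := by
  classical
  have hc : ∀ i : ι, ∃ c : Fin n → ℤ, ∀ x ∈ P, g x = i → ∀ k, |f x k - c k| ≤ L := by
    intro i
    by_cases h : ∃ y ∈ P, g y = i
    · obtain ⟨y, hy, rfl⟩ := h
      exact ⟨f y, fun x hx hxy => hf x hx y hy hxy⟩
    · exact ⟨0, fun x hx hxi => absurd ⟨x, hx, hxi⟩ h⟩
  choose c hc using hc
  refine ⟨G.biUnion fun i => Fintype.piFinset fun k => Finset.Icc (c i k - L) (c i k + L), ?_, ?_⟩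
  · intro x hx
    refine Finset.mem_biUnion.2 ⟨g x, hg x hx, Fintype.mem_piFinset.2 fun k => ?_⟩
    have := abs_le.1 (hc (g x) x hx rfl k)
    rw [Finset.mem_Icc]; constructor <;> linarith
  · refine Finset.card_biUnion_le_card_mul _ _ _ fun i _ => ?_
    rw [Fintype.card_piFinset]
    refine (Finset.prod_le_pow_card _ _ (2 * L + 1) fun k _ => ?_).trans_eq (by simp)
    rw [Int.card_Icc]; omega

theorem card_filter_piFinset_le {m : ℕ} (I : Finset ℤ) (i : Fin (m + 1)) (F : (Fin m → ℤ) → ℤ) :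
    ((Fintype.piFinset fun _ : Fin (m + 1) => I).filter
      fun g => g i = F fun k => g (i.succAbove k)).card ≤ I.card ^ m := by
  classical
  have : (Fintype.piFinset fun _ : Fin m => I).card = I.card ^ m := by simp
  rw [← this]
  refine Finset.card_le_card_of_injOn (fun g k => g (i.succAbove k)) ?_ ?_
  · intro g hg
    rw [Finset.mem_coe, Finset.mem_filter, Fintype.mem_piFinset] at hg
    rw [Finset.mem_coe, Fintype.mem_piFinset]
    exact fun k => hg.1 _
  · intro g hg g' hg' h
    rw [Finset.mem_coe, Finset.mem_filter] at hg hg'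
    dsimp only at h
    ext k
    rcases Fin.eq_self_or_eq_succAbove i k with rfl | ⟨k, rfl⟩
    · rw [hg.2, hg'.2, h]
    · exact congrFun h k

/-- The integer vectors with entries in `I` that have an entry in `D` or two equal entries. -/
noncomputable def degenerateVectors (m : ℕ) (I D : Finset ℤ) : Finset (Fin (m + 1) → ℤ) :=
  (Fintype.piFinset fun _ => I).filter fun g => (∃ i, g i ∈ D) ∨ ∃ i j, i ≠ j ∧ g i = g j

theorem card_degenerateVectors_le (m : ℕ) (I D : Finset ℤ) :
    (degenerateVectors m I D).card ≤ (m + 1) * (D.card + m) * I.card ^ m := by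
  classical
  have hsub : degenerateVectors m I D ⊆ Finset.univ.biUnion fun i : Fin (m + 1) =>
      (D.biUnion fun d => (Fintype.piFinset fun _ : Fin (m + 1) => I).filter
        fun g => g i = (fun _ => d) fun k => g (i.succAbove k)) ∪
      (Finset.univ.biUnion fun j : Fin m => (Fintype.piFinset fun _ : Fin (m + 1) => I).filter
        fun g => g i = (fun h => h j) fun k => g (i.succAbove k)) := by
    intro g hg
    obtain ⟨hI, hg⟩ := Finset.mem_filter.1 hg
    rcases hg with ⟨i, hi⟩ | ⟨i, j, hij, h⟩
    · exact Finset.mem_biUnion.2 ⟨i, Finset.mem_univ _, Finset.mem_union_left _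
        (Finset.mem_biUnion.2 ⟨g i, hi, Finset.mem_filter.2 ⟨hI, rfl⟩⟩)⟩
    · obtain ⟨j, rfl⟩ := Fin.exists_succAbove_eq hij.symm
      exact Finset.mem_biUnion.2 ⟨i, Finset.mem_univ _, Finset.mem_union_right _
        (Finset.mem_biUnion.2 ⟨j, Finset.mem_univ _, Finset.mem_filter.2 ⟨hI, h⟩⟩)⟩
  refine (Finset.card_le_card hsub).trans ?_
  have : (m + 1) * (D.card + m) * I.card ^ m =
      (Finset.univ : Finset (Fin (m + 1))).card * ((D.card + m) * I.card ^ m) := by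
    simp [mul_assoc]
  rw [this]
  refine Finset.card_biUnion_le_card_mul _ _ _ fun i _ => ?_
  refine (Finset.card_union_le _ _).trans ?_
  rw [add_mul]
  refine add_le_add ?_ ?_
  · exact Finset.card_biUnion_le_card_mul _ _ _ fun d _ =>
      card_filter_piFinset_le I i fun _ => d
  · have := Finset.card_biUnion_le_card_mul (Finset.univ : Finset (Fin m))
      (fun j => (Fintype.piFinset fun _ : Fin (m + 1) => I).filter
        fun g => g i = (fun h => h j) fun k => g (i.succAbove k)) _
      fun j _ => card_filter_piFinset_le I i fun h => h j
    simpa using this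

end LatticePoints

section LatticePoints
open MeasureTheory

/-- The closure conditions of `rootRegion`. -/
def closedRootRegion (m : ℕ) (B : ℝ) : Set (Fin (m + 1) → ℝ) :=
  {θ | Antitone θ ∧ (2 ≤ θ 0 ∧ θ 0 ≤ B) ∧ ∀ i : Fin m, -2 ≤ θ i.succ ∧ θ i.succ ≤ 2}

theorem rootRegion_subset_closedRootRegion (m : ℕ) (B : ℝ) :
    rootRegion m B ⊆ closedRootRegion m B := fun _ ⟨h1, h2, h3⟩ =>
  ⟨h1.antitone, ⟨h2.1.le, h2.2⟩, fun i => ⟨(h3 i).1.le, (h3 i).2.le⟩⟩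

theorem isCompact_closedRootRegion (m : ℕ) (B : ℝ) : IsCompact (closedRootRegion m B) := by
  have hK : IsCompact (Set.Icc (fun _ : Fin (m + 1) => (-2 : ℝ)) (fun _ => max 2 B)) := isCompact_Icc
  refine hK.of_isClosed_subset ?_ ?_
  · have : closedRootRegion m B = (⋂ i, ⋂ j, ⋂ _ : i ≤ j, {θ : Fin (m + 1) → ℝ | θ j ≤ θ i}) ∩
        ({θ | 2 ≤ θ 0} ∩ {θ | θ 0 ≤ B}) ∩
        ⋂ i : Fin m, ({θ | -2 ≤ θ i.succ} ∩ {θ | θ i.succ ≤ 2}) := by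
      ext θ
      simp [closedRootRegion, Antitone, and_assoc]
    rw [this]
    refine (IsClosed.inter ?_ (IsClosed.inter ?_ ?_)).inter ?_
    · exact isClosed_iInter fun i => isClosed_iInter fun j => isClosed_iInter fun _ =>
        isClosed_le (continuous_apply j) (continuous_apply i)
    · exact isClosed_le continuous_const (continuous_apply 0)
    · exact isClosed_le (continuous_apply 0) continuous_const
    · exact isClosed_iInter fun i => (isClosed_le continuous_const (continuous_apply _)).inter
        (isClosed_le (continuous_apply _) continuous_const)
  · rintro θ ⟨-, h1, h2⟩
    constructor <;> intro i <;> refine Fin.cases ?_ (fun i => ?_) i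
    · simp only; linarith
    · exact (h2 i).1
    · exact h1.2.trans (le_max_right _ _)
    · exact (h2 i).2.trans (le_max_left _ _)

theorem isBounded_coeffRegion (m : ℕ) (B : ℝ) : Bornology.IsBounded (coeffRegion m B) :=
  ((isCompact_closedRootRegion m B).image (contDiff_rootCoeff _).continuous).isBounded.subset
    (Set.image_mono (rootRegion_subset_closedRootRegion m B))

theorem mem_nhds_rootRegion {m : ℕ} {B : ℝ} {θ : Fin (m + 1) → ℝ} (h : θ ∈ rootRegion m B)
    (hB : θ 0 < B) : rootRegion m B ∈ nhds θ := by
  obtain ⟨h1, h2, h3⟩ := h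
  have e1 : ∀ᶠ τ in nhds θ, ∀ i j : Fin (m + 1), i < j → τ j < τ i := by
    simp only [Filter.eventually_all]
    exact fun i j hij => (continuous_apply j).continuousAt.eventually_lt
      (continuous_apply i).continuousAt (h1 hij)
  have e2 : ∀ᶠ τ : Fin (m + 1) → ℝ in nhds θ, 2 < τ 0 :=
    continuousAt_const.eventually_lt (continuous_apply 0).continuousAt h2.1
  have e3 : ∀ᶠ τ : Fin (m + 1) → ℝ in nhds θ, τ 0 < B :=
    (continuous_apply 0).continuousAt.eventually_lt continuousAt_const hB
  have e4 : ∀ᶠ τ : Fin (m + 1) → ℝ in nhds θ, ∀ i : Fin m, -2 < τ i.succ ∧ τ i.succ < 2 := by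
    simp only [Filter.eventually_all]
    exact fun i => (continuousAt_const.eventually_lt (continuous_apply _).continuousAt (h3 i).1).and
      ((continuous_apply _).continuousAt.eventually_lt continuousAt_const (h3 i).2)
  filter_upwards [e1, e2, e3, e4] with τ f1 f2 f3 f4
  exact ⟨fun i j hij => f1 i j hij, ⟨f2, f3.le⟩, f4⟩

/-- The tuples of `closedRootRegion` that lie on its boundary. -/
def degenerateRoots (m : ℕ) (B : ℝ) : Set (Fin (m + 1) → ℝ) :=
  {θ ∈ closedRootRegion m B | θ 0 = 2 ∨ θ 0 = B ∨ (∃ i : Fin m, θ i.succ = 2 ∨ θ i.succ = -2) ∨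
    ∃ i j : Fin m, i ≠ j ∧ θ i.succ = θ j.succ}

theorem frontier_coeffRegion_subset (m : ℕ) (B : ℝ) :
    frontier (coeffRegion m B) ⊆ rootCoeff '' degenerateRoots m B := by
  rintro x ⟨hxc, hxi⟩
  have hcl : closure (coeffRegion m B) ⊆ rootCoeff '' closedRootRegion m B :=
    closure_minimal (Set.image_mono (rootRegion_subset_closedRootRegion m B))
      ((isCompact_closedRootRegion m B).image (contDiff_rootCoeff _).continuous).isClosed
  obtain ⟨θ, hθ, rfl⟩ := hcl hxc
  refine ⟨θ, ⟨hθ, ?_⟩, rfl⟩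
  by_contra! hc
  obtain ⟨c1, c2, c3, c4⟩ := hc
  obtain ⟨h1, h2, h3⟩ := hθ
  have h2' : 2 < θ 0 := lt_of_le_of_ne h2.1 (Ne.symm c1)
  have h3' : ∀ i : Fin m, -2 < θ i.succ ∧ θ i.succ < 2 := fun i =>
    ⟨lt_of_le_of_ne (h3 i).1 (Ne.symm (c3 i).2), lt_of_le_of_ne (h3 i).2 (c3 i).1⟩
  have hinj : Function.Injective θ := by
    intro i j
    refine Fin.cases ?_ (fun i => ?_) i <;> refine Fin.cases ?_ (fun j => ?_) j
    · exact fun _ => rfl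
    · intro h; linarith [(h3' j).2]
    · intro h; linarith [(h3' i).2]
    · intro h
      by_contra hij
      exact c4 i j (fun e => hij (e ▸ rfl)) h
  have hmem : θ ∈ rootRegion m B := ⟨h1.strictAnti_of_injective hinj, ⟨h2', h2.2⟩, h3'⟩
  refine hxi (mem_interior_iff_mem_nhds.2 ?_)
  rw [← map_nhds_rootCoeff hinj]
  exact Filter.image_mem_map (mem_nhds_rootRegion hmem (lt_of_le_of_ne h2.2 c2))

theorem rootPoly_univ_succ {m : ℕ} (θ : Fin (m + 1) → ℝ) :
    rootPoly Finset.univ θ =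
      (Polynomial.X - Polynomial.C (θ 0)) * rootPoly Finset.univ (Fin.tail θ) := by
  simp only [rootPoly, Fin.prod_univ_succ, Fin.tail]

theorem exists_bound_rootPoly_coeff (m : ℕ) : ∃ M : ℝ, 0 ≤ M ∧ ∀ τ ∈ cube m, ∀ k < m + 1,
    |(rootPoly Finset.univ τ).coeff k| ≤ M := by
  have hc : Continuous fun τ : Fin m → ℝ => fun k : Fin (m + 1) => (rootPoly Finset.univ τ).coeff k :=
    continuous_pi fun k => (contDiff_rootPoly_coeff _ _).continuous
  obtain ⟨M, hM⟩ := (isCompact_cube m).exists_bound_of_continuousOn hc.continuousOn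
  refine ⟨max M 0, le_max_right _ _, fun τ hτ k hk => ?_⟩
  exact ((norm_le_pi_norm (fun k : Fin (m + 1) => (rootPoly Finset.univ τ).coeff k) ⟨k, hk⟩).trans
    (hM τ hτ)).trans (le_max_left _ _)

theorem exists_lipschitz_rootPoly_coeff (m : ℕ) : ∃ K : ℝ, 0 ≤ K ∧ ∀ τ ∈ cube m, ∀ ρ ∈ cube m,
    ∀ k < m + 1, |(rootPoly Finset.univ τ).coeff k - (rootPoly Finset.univ ρ).coeff k| ≤
      K * ‖τ - ρ‖ := by
  have hc : ContDiff ℝ 1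
      fun τ : Fin m → ℝ => fun k : Fin (m + 1) => (rootPoly Finset.univ τ).coeff k :=
    contDiff_pi.2 fun k => contDiff_rootPoly_coeff _ _
  obtain ⟨K, hK⟩ := hc.contDiffOn.exists_lipschitzOnWith one_ne_zero
    (convex_pi fun i _ => convex_Icc (-2 : ℝ) 2) (isCompact_cube m)
  refine ⟨K, K.2, fun τ hτ ρ hρ k hk => ?_⟩
  have h := hK.dist_le_mul τ hτ ρ hρ
  rw [dist_eq_norm, dist_eq_norm] at h
  exact (norm_le_pi_norm ((fun k : Fin (m + 1) => (rootPoly Finset.univ τ).coeff k) -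
    fun k : Fin (m + 1) => (rootPoly Finset.univ ρ).coeff k) ⟨k, hk⟩).trans h

theorem tail_mem_cube {m : ℕ} {B : ℝ} {θ : Fin (m + 1) → ℝ} (h : θ ∈ closedRootRegion m B) :
    Fin.tail θ ∈ cube m := mem_cube.2 fun i => h.2.2 i

theorem exists_variation_rootCoeff (m : ℕ) : ∃ L : ℝ, ∀ (B : ℝ) (N : ℕ), 2 ≤ B → B ≤ N →
    ∀ θ ∈ closedRootRegion m B, ∀ τ ∈ closedRootRegion m B, |θ 0 - τ 0| ≤ 1 →
      (∀ i : Fin m, N * |θ i.succ - τ i.succ| ≤ 1) → ∀ k, |rootCoeff θ k - rootCoeff τ k| ≤ L := by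
  obtain ⟨M, hM0, hM⟩ := exists_bound_rootPoly_coeff m
  obtain ⟨K, hK0, hK⟩ := exists_lipschitz_rootPoly_coeff m
  refine ⟨M + K + K, fun B N hB hN θ hθ τ hτ h0 hs k => ?_⟩
  have hN0 : (0 : ℝ) < N := by linarith
  have hdist : ‖Fin.tail θ - Fin.tail τ‖ ≤ 1 / N := by
    refine (pi_norm_le_iff_of_nonneg (by positivity)).2 fun i => ?_
    rw [le_div_iff₀ hN0, mul_comm]
    exact hs i
  have hdiff : ∀ k < m + 1, |(rootPoly Finset.univ (Fin.tail θ)).coeff k -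
      (rootPoly Finset.univ (Fin.tail τ)).coeff k| ≤ K * (1 / N) := fun k hk =>
    (hK _ (tail_mem_cube hθ) _ (tail_mem_cube hτ) k hk).trans (by gcongr)
  have hKN : K * (1 / N) ≤ K := by
    refine mul_le_of_le_one_right hK0 ?_
    rw [div_le_one hN0]; linarith
  have hmul : ∀ k < m + 1, |θ 0 * (rootPoly Finset.univ (Fin.tail θ)).coeff k -
      τ 0 * (rootPoly Finset.univ (Fin.tail τ)).coeff k| ≤ M + K := by
    intro k hk
    set a := (rootPoly Finset.univ (Fin.tail θ)).coeff k with ha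
    set b := (rootPoly Finset.univ (Fin.tail τ)).coeff k with hb
    have e : θ 0 * a - τ 0 * b = (θ 0 - τ 0) * a + τ 0 * (a - b) := by ring
    rw [e]
    refine (abs_add_le _ _).trans (add_le_add ?_ ?_)
    · rw [abs_mul]
      calc |θ 0 - τ 0| * |a| ≤ 1 * M := by
            gcongr; exact hM _ (tail_mem_cube hθ) k hk
        _ = M := one_mul M
    · rw [abs_mul]
      have hτ0 : |τ 0| ≤ N := by
        rw [abs_le]; constructor <;> linarith [hτ.2.1.1, hτ.2.1.2]
      calc |τ 0| * |a - b| ≤ N * (K * (1 / N)) := by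
            gcongr; exact hdiff k hk
        _ = K := by field_simp
  obtain ⟨k, hk⟩ := k
  simp only [rootCoeff, rootPoly_univ_succ]
  cases k with
  | zero =>
    rw [coeff_X_sub_C_mul_zero, coeff_X_sub_C_mul_zero, neg_sub_neg, abs_sub_comm]
    linarith [hmul 0 hk]
  | succ k =>
    rw [coeff_X_sub_C_mul_succ, coeff_X_sub_C_mul_succ, sub_sub_sub_comm]
    refine (abs_sub _ _).trans ?_
    linarith [hmul (k + 1) hk, hdiff k (by omega)]

/-- The integer grid cell of a tuple of roots. -/
noncomputable def gridIndex {m : ℕ} (N : ℕ) (θ : Fin (m + 1) → ℝ) : Fin (m + 1) → ℤ :=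
  Fin.cons ⌊θ 0⌋ fun i : Fin m => ⌊N * θ i.succ⌋

theorem gridIndex_mem_degenerateVectors {m N : ℕ} {B : ℝ} (hB : 2 ≤ B) (hN : B ≤ N)
    {θ : Fin (m + 1) → ℝ} (hθ : θ ∈ degenerateRoots m B) :
    gridIndex N θ ∈ degenerateVectors m (Finset.Icc (-(2 * N)) (2 * N))
      {2, ⌊B⌋, (2 * N : ℤ), -(2 * N : ℤ)} := by
  obtain ⟨⟨-, h1, h2⟩, h⟩ := hθ
  have hN2 : (2 : ℝ) ≤ N := hB.trans hN
  have hfloor2 : ⌊(N : ℝ) * 2⌋ = 2 * N := by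
    rw [Int.floor_eq_iff]; push_cast; constructor <;> linarith
  have hfloorneg : ⌊(N : ℝ) * -2⌋ = -(2 * N) := by
    rw [Int.floor_eq_iff]; push_cast; constructor <;> linarith
  refine Finset.mem_filter.2 ⟨Fintype.mem_piFinset.2 fun i => ?_, ?_⟩
  · rw [Finset.mem_Icc]
    refine Fin.cases ?_ (fun i => ?_) i
    · simp only [gridIndex, Fin.cons_zero]
      rw [Int.le_floor, ← Int.lt_add_one_iff, Int.floor_lt]
      push_cast
      constructor <;> linarith
    · simp only [gridIndex, Fin.cons_succ]
      rw [← hfloorneg, ← hfloor2]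
      exact ⟨Int.floor_le_floor (by nlinarith [(h2 i).1]), Int.floor_le_floor (by nlinarith [(h2 i).2])⟩
  · rcases h with h | h | ⟨i, h | h⟩ | ⟨i, j, hij, h⟩
    · exact Or.inl ⟨0, by simp [gridIndex, h]⟩
    · exact Or.inl ⟨0, by simp [gridIndex, h]⟩
    · refine Or.inl ⟨i.succ, ?_⟩
      simp only [gridIndex, Fin.cons_succ, h, hfloor2]; simp
    · refine Or.inl ⟨i.succ, ?_⟩
      simp only [gridIndex, Fin.cons_succ, h, hfloorneg]; simp
    · refine Or.inr ⟨i.succ, j.succ, fun e => hij (Fin.succ_injective _ e), ?_⟩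
      simp only [gridIndex, Fin.cons_succ, h]

theorem abs_floor_sub_floor_le {x y L : ℝ} (h : |x - y| ≤ L) : |⌊x⌋ - ⌊y⌋| ≤ (⌈L⌉₊ + 1 : ℕ) := by
  have h1 := Nat.le_ceil L
  have h2 := abs_le.1 h
  have hx := Int.floor_le x
  have hx' := Int.lt_floor_add_one x
  have hy := Int.floor_le y
  have hy' := Int.lt_floor_add_one y
  rw [← @Int.cast_le ℝ]
  push_cast
  rw [abs_le]
  constructor <;> linarith

theorem exists_abs_ncard_coeffRegion_sub_volume_le (m : ℕ) : ∃ C : ℝ, ∀ B : ℝ, 2 ≤ B →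
    |({z : Fin (m + 1) → ℤ | (fun i => (z i : ℝ)) ∈ coeffRegion m B}.ncard : ℝ) -
      (volume (coeffRegion m B)).toReal| ≤ C * B ^ m := by
  obtain ⟨L, hL⟩ := exists_variation_rootCoeff m
  set L' := ⌈L⌉₊ + 1 with hL'
  refine ⟨(m + 1) * (4 + m) * 9 ^ m * (2 * L' + 1) ^ (m + 1), fun B hB => ?_⟩
  set N := ⌈B⌉₊ with hN
  have hBN : B ≤ N := Nat.le_ceil B
  have hNB : (N : ℝ) < B + 1 := Nat.ceil_lt_add_one (by linarith)
  set D : Finset ℤ := {2, ⌊B⌋, (2 * N : ℤ), -(2 * N : ℤ)} with hD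
  set G := degenerateVectors m (Finset.Icc (-(2 * N)) (2 * N)) D with hG
  obtain ⟨T, hT, hTcard⟩ := exists_finset_image_subset_of_fiberwise (P := degenerateRoots m B)
    (f := fun θ => floorVec (rootCoeff θ)) (g := gridIndex N) (G := G) (L := L')
    (fun θ hθ => gridIndex_mem_degenerateVectors hB hBN hθ) (by
      intro θ hθ τ hτ h k
      refine abs_floor_sub_floor_le (hL B N hB hBN θ hθ.1 τ hτ.1 ?_ ?_ k)
      · have := congrFun h 0
        simp only [gridIndex, Fin.cons_zero] at this
        exact (Int.abs_sub_lt_one_of_floor_eq_floor this).le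
      · intro i
        have := congrFun h i.succ
        simp only [gridIndex, Fin.cons_succ] at this
        have h2 := (Int.abs_sub_lt_one_of_floor_eq_floor this).le
        rwa [← mul_sub, abs_mul, Nat.abs_cast] at h2)
  have hmain := abs_ncard_sub_volume_le (isBounded_coeffRegion m B) (measurableSet_coeffRegion m B)
    (T := T) (by
      intro x hx
      obtain ⟨θ, hθ, rfl⟩ := frontier_coeffRegion_subset m B hx
      exact hT θ hθ)
  refine hmain.trans ?_
  have hDcard : D.card ≤ 4 := Finset.card_le_four
  have hGcard : (G.card : ℝ) ≤ (m + 1) * (4 + m) * (9 ^ m * B ^ m) := by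
    have h1 := card_degenerateVectors_le m (Finset.Icc (-(2 * N : ℤ)) (2 * N)) D
    have h2 : (Finset.Icc (-(2 * N : ℤ)) (2 * N)).card = 4 * N + 1 := by
      rw [Int.card_Icc]; omega
    rw [h2] at h1
    have h3 : (G.card : ℝ) ≤ (m + 1) * (D.card + m) * (4 * N + 1) ^ m := by exact_mod_cast h1
    refine h3.trans ?_
    rw [← mul_pow]
    have h4 : (D.card : ℝ) ≤ 4 := by exact_mod_cast hDcard
    gcongr
    linarith
  have hT2 : (T.card : ℝ) ≤ G.card * (2 * L' + 1) ^ (m + 1) := by exact_mod_cast hTcard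
  refine hT2.trans ?_
  calc (G.card : ℝ) * (2 * L' + 1) ^ (m + 1) ≤
      ((m + 1) * (4 + m) * (9 ^ m * B ^ m)) * (2 * L' + 1) ^ (m + 1) := by gcongr
    _ = _ := by ring

end LatticePoints

section TraceField
open Polynomial IntermediateField

theorem exists_algHom_adjoin_apply_eq {α : ℝ} (hα : IsIntegral ℚ α) (x : ℚ⟮α⟯) {y : ℂ}
    (hy : aeval y (minpoly ℚ (x : ℝ)) = 0) : ∃ φ : ℚ⟮α⟯ →ₐ[ℚ] ℂ, φ x = y := by
  have halg : Algebra.IsAlgebraic ℚ ℚ⟮α⟯ := isAlgebraic_adjoin_simple hα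
  refine exists_algHom_of_splits_of_aeval
    (fun s => ⟨(Algebra.IsAlgebraic.isAlgebraic s).isIntegral, IsAlgClosed.splits _⟩) ?_
  rw [← hy, ← minpoly.algebraMap_eq (A := ℚ) (algebraMap ℚ⟮α⟯ ℝ).injective x]
  rfl

theorem aeval_algHom_adjoin_eq_zero {α : ℝ} (φ : ℚ⟮α⟯ →ₐ[ℚ] ℂ) (x : ℚ⟮α⟯) :
    aeval (φ x) (minpoly ℚ (x : ℝ)) = 0 := by
  rw [aeval_algHom_apply]
  have : minpoly ℚ (x : ℝ) = minpoly ℚ x :=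
    minpoly.algebraMap_eq (A := ℚ) (algebraMap ℚ⟮α⟯ ℝ).injective x
  rw [this, minpoly.aeval, map_zero]

theorem exists_algHom_gen {α : ℝ} (hα : IsIntegral ℚ α) {w : ℂ}
    (hw : aeval w (minpoly ℚ α) = 0) :
    ∃ φ : ℚ⟮α⟯ →ₐ[ℚ] ℂ, φ (AdjoinSimple.gen ℚ α) = w :=
  exists_algHom_adjoin_apply_eq hα (AdjoinSimple.gen ℚ α) (by simpa using hw)

theorem aeval_add_inv_minpoly {α : ℝ} (hα : IsIntegral ℚ α) {w : ℂ}
    (hw : aeval w (minpoly ℚ α) = 0) : aeval (w + w⁻¹) (minpoly ℚ (α + α⁻¹)) = 0 := by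
  obtain ⟨φ, rfl⟩ := exists_algHom_gen hα hw
  have := aeval_algHom_adjoin_eq_zero φ (AdjoinSimple.gen ℚ α + (AdjoinSimple.gen ℚ α)⁻¹)
  simpa using this

theorem exists_root_add_inv_eq {α : ℝ} (hα : IsIntegral ℚ α) {γ : ℂ}
    (hγ : aeval γ (minpoly ℚ (α + α⁻¹)) = 0) :
    ∃ w : ℂ, aeval w (minpoly ℚ α) = 0 ∧ w + w⁻¹ = γ := by
  obtain ⟨φ, hφ⟩ := exists_algHom_adjoin_apply_eq hα
    (AdjoinSimple.gen ℚ α + (AdjoinSimple.gen ℚ α)⁻¹) (y := γ) (by simpa using hγ)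
  refine ⟨φ (AdjoinSimple.gen ℚ α), ?_, ?_⟩
  · simpa using aeval_algHom_adjoin_eq_zero φ (AdjoinSimple.gen ℚ α)
  · rw [← hφ, map_add, map_inv₀]

theorem aeval_inv_minpoly {α : ℝ} (hα : IsIntegral ℚ α) {w : ℂ} (hw : aeval w (minpoly ℚ α) = 0)
    (hw' : aeval w⁻¹ (minpoly ℚ α) = 0) : aeval α⁻¹ (minpoly ℚ α) = 0 := by
  obtain ⟨φ, rfl⟩ := exists_algHom_gen hα hw
  rw [← map_inv₀, aeval_algHom_apply, map_eq_zero] at hw'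
  have := congrArg (algebraMap ℚ⟮α⟯ ℝ) hw'
  rw [← aeval_algebraMap_apply, map_zero] at this
  simpa using this

theorem aeval_inv_minpoly_of_aeval_inv {α : ℝ} (hα : IsIntegral ℚ α)
    (h : aeval α⁻¹ (minpoly ℚ α) = 0) {w : ℂ} (hw : aeval w (minpoly ℚ α) = 0) :
    aeval w⁻¹ (minpoly ℚ α) = 0 := by
  obtain ⟨φ, rfl⟩ := exists_algHom_gen hα hw
  rw [← map_inv₀, aeval_algHom_apply]
  have h2 : aeval (AdjoinSimple.gen ℚ α)⁻¹ (minpoly ℚ α) = 0 := by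
    apply (algebraMap ℚ⟮α⟯ ℝ).injective
    rw [← aeval_algebraMap_apply, map_zero]
    simpa using h
  rw [h2, map_zero]

theorem im_eq_zero_of_mem_adjoin {K : Type*} [Field K] [Algebra ℚ K] (φ : K →ₐ[ℚ] ℂ) {a b : K}
    (h : a ∈ ℚ⟮b⟯) (hb : (φ b).im = 0) : (φ a).im = 0 := by
  obtain ⟨r, s, rfl⟩ := (mem_adjoin_simple_iff ℚ a).1 h
  obtain ⟨t, ht⟩ : ∃ t : ℝ, φ b = algebraMap ℝ ℂ t := ⟨(φ b).re, by
    apply Complex.ext <;> simp [hb]⟩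
  rw [map_div₀, ← aeval_algHom_apply, ← aeval_algHom_apply, ht, aeval_algebraMap_apply,
    aeval_algebraMap_apply, ← map_div₀]
  exact Complex.ofReal_im _

theorem finrank_eq_two_mul_natDegree {K : Type*} [Field K] [Algebra ℚ K] {a : K}
    (ha0 : a ≠ 0) (ha : IsIntegral ℚ a) (htop : ℚ⟮a⟯ = ⊤) (φ : K →ₐ[ℚ] ℂ)
    (him : (φ a).im ≠ 0) (hre : (φ (a + a⁻¹)).im = 0) :
    Module.finrank ℚ K = 2 * (minpoly ℚ (a + a⁻¹)).natDegree := by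
  set b := a + a⁻¹ with hb
  have hbi : IsIntegral ℚ b := ha.add ha.inv
  have hai : IsIntegral ℚ⟮b⟯ a := ha.tower_top
  have hgen : ℚ⟮b⟯⟮a⟯ = ⊤ := by
    rw [← restrictScalars_eq_top_iff (K := ℚ), eq_top_iff, ← htop]
    refine le_trans (adjoin.mono _ _ {b, a} (by simp)) ?_
    exact (adjoin_simple_adjoin_simple ℚ b a).ge
  have hdeg2 : 2 ≤ (minpoly ℚ⟮b⟯ a).natDegree := by
    rw [minpoly.two_le_natDegree_iff hai]
    rintro ⟨x, hx⟩
    exact him (im_eq_zero_of_mem_adjoin φ (hx ▸ x.2) hre)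
  have hdeg2' : (minpoly ℚ⟮b⟯ a).natDegree ≤ 2 := by
    set q : ℚ⟮b⟯[X] := X ^ 2 - C (AdjoinSimple.gen ℚ b) * X + 1 with hq
    have hqd : q.natDegree = 2 := by rw [hq]; compute_degree!
    have hqm : q.Monic := by rw [hq]; monicity!
    have h0 : aeval a q = 0 := by
      simp only [hq, map_add, map_sub, map_pow, map_mul, aeval_X, aeval_C, map_one,
        AdjoinSimple.algebraMap_gen, hb]
      field_simp; ring
    rw [← hqd]
    exact natDegree_le_natDegree (minpoly.min _ _ hqm h0)
  have hF : Module.finrank ℚ⟮b⟯ K = 2 := by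
    rw [← finrank_top', ← hgen, adjoin.finrank hai]
    omega
  rw [← Module.finrank_mul_finrank ℚ ℚ⟮b⟯ K, hF, adjoin.finrank hbi, mul_comm]

theorem natDegree_minpoly_eq_two_mul {α : ℝ} (hα0 : α ≠ 0) (hα : IsIntegral ℚ α) {w : ℂ}
    (hw : aeval w (minpoly ℚ α) = 0) (him : w.im ≠ 0) (hre : (w + w⁻¹).im = 0) :
    (minpoly ℚ α).natDegree = 2 * (minpoly ℚ (α + α⁻¹)).natDegree := by
  obtain ⟨φ, rfl⟩ := exists_algHom_gen hα hw
  have hint : IsIntegral ℚ (AdjoinSimple.gen ℚ α) := (AdjoinSimple.isIntegral_gen ℚ α).2 hα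
  have hmin : minpoly ℚ (AdjoinSimple.gen ℚ α + (AdjoinSimple.gen ℚ α)⁻¹) =
      minpoly ℚ (α + α⁻¹) := by
    rw [← minpoly.algebraMap_eq (A := ℚ) (algebraMap ℚ⟮α⟯ ℝ).injective]
    simp
  have hg0 : AdjoinSimple.gen ℚ α ≠ 0 := by
    intro h
    have := congrArg (algebraMap ℚ⟮α⟯ ℝ) h
    simp [hα0] at this
  rw [← adjoin.finrank hα, ← hmin]
  refine finrank_eq_two_mul_natDegree hg0 hint ?_ φ him (by simpa using hre)
  have : FiniteDimensional ℚ ℚ⟮α⟯ := adjoin.finiteDimensional hα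
  rw [Field.primitive_element_iff_minpoly_natDegree_eq, adjoin.finrank hα]
  exact congrArg natDegree (minpoly_gen ℚ α)

theorem norm_eq_one_of_add_inv_eq_ofReal {w : ℂ} {t : ℝ} (hw : w ≠ 0) (h : w + w⁻¹ = t)
    (ht : |t| < 2) : ‖w‖ = 1 ∧ w.im ≠ 0 := by
  have h1 : w * w + 1 = t * w := by
    rw [← h]; field_simp
  have hre := congrArg Complex.re h1
  have him := congrArg Complex.im h1
  simp at hre him
  have ht2 : t ^ 2 < 4 := by
    have := sq_lt_sq' (by linarith [abs_lt.1 ht |>.1]) (abs_lt.1 ht).2; linarith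
  have hy : w.im ≠ 0 := by
    intro hy
    rw [hy] at hre
    nlinarith [sq_nonneg (w.re - t / 2)]
  have hx : t = 2 * w.re := by
    apply mul_right_cancel₀ hy; linarith
  refine ⟨?_, hy⟩
  have : Complex.normSq w = 1 := by
    rw [Complex.normSq_apply]; rw [hx] at hre; linarith
  rw [Complex.norm_def, this, Real.sqrt_one]

theorem eq_or_eq_inv_of_add_inv_eq {F : Type*} [Field F] {w a : F} (hw : w ≠ 0) (ha : a ≠ 0)
    (h : w + w⁻¹ = a + a⁻¹) : w = a ∨ w = a⁻¹ := by
  have h1 : (w - a) * (w - a⁻¹) = 0 := by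
    field_simp at h ⊢
    linear_combination h
  rcases mul_eq_zero.1 h1 with h | h
  · exact Or.inl (sub_eq_zero.1 h)
  · exact Or.inr (sub_eq_zero.1 h)

end TraceField

section TracePolynomials
open Polynomial

/-- The monic integer polynomials of degree `m + 1` with one root in `(2, B]` and `m` distinct roots
in `(-2, 2)`. -/
def tracePolys (m : ℕ) (B : ℝ) : Set ℤ[X] :=
  {p | p.Monic ∧ ∃ θ ∈ rootRegion m B, p.map (Int.castRingHom ℝ) = rootPoly Finset.univ θ}

theorem exists_strictAnti_rootPoly_eq {n : ℕ} {p : ℝ[X]} (hp : p.Monic) (hd : p.natDegree = n)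
    (hnd : (p.map Complex.ofRealHom).roots.Nodup)
    (hreal : ∀ z ∈ (p.map Complex.ofRealHom).roots, z.im = 0) :
    ∃ θ : Fin n → ℝ, StrictAnti θ ∧ p = rootPoly Finset.univ θ := by
  classical
  set R := (p.map Complex.ofRealHom).roots.toFinset with hR
  have hRcard : R.card = n := by
    rw [hR, Multiset.toFinset_card_of_nodup hnd, IsAlgClosed.card_roots_eq_natDegree,
      natDegree_map, hd]
  have hmem : ∀ z ∈ R, z = (z.re : ℂ) ∧ p.eval z.re = 0 := by
    intro z hz
    rw [hR, Multiset.mem_toFinset] at hz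
    have h1 : z = (z.re : ℂ) := by
      apply Complex.ext <;> simp [hreal z hz]
    refine ⟨h1, ?_⟩
    have h2 := (mem_roots'.1 hz).2
    rw [IsRoot, h1] at h2
    have h3 : (p.map Complex.ofRealHom).eval (Complex.ofRealHom z.re) = 0 := h2
    rw [eval_map_apply] at h3
    exact Complex.ofReal_eq_zero.1 h3
  set s := R.image Complex.re with hs
  have hscard : s.card = n := by
    rw [hs, Finset.card_image_of_injOn, hRcard]
    intro z hz w hw h
    rw [(hmem z hz).1, (hmem w hw).1]
    exact congrArg _ h
  have hsroot : ∀ x ∈ s, p.eval x = 0 := by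
    intro x hx
    obtain ⟨z, hz, rfl⟩ := Finset.mem_image.1 hx
    exact (hmem z hz).2
  have hle : s.val ≤ p.roots := (Multiset.le_iff_subset s.nodup).2 fun x hx =>
    (mem_roots hp.ne_zero).2 (hsroot x hx)
  have heq : s.val = p.roots := by
    refine Multiset.eq_of_le_of_card_le hle ((card_roots' p).trans ?_)
    rw [hd, ← hscard]; rfl
  refine ⟨fun i => s.orderEmbOfFin hscard i.rev, fun i j hij => ?_, ?_⟩
  · exact (s.orderEmbOfFin hscard).strictMono (Fin.rev_lt_rev.2 hij)
  · rw [← prod_multiset_X_sub_C_of_monic_of_roots_card_eq hp (by rw [← heq, hd, ← hscard]; rfl),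
      ← heq]
    change ∏ r ∈ s, (X - C r) = ∏ i : Fin n, (X - C (s.orderEmbOfFin hscard (Fin.revPerm i)))
    rw [Equiv.prod_comp Fin.revPerm fun i => (X - C (s.orderEmbOfFin hscard i) : ℝ[X])]
    conv_lhs => rw [← Finset.image_orderEmbOfFin_univ s hscard]
    rw [Finset.prod_image fun i _ j _ h => (s.orderEmbOfFin hscard).injective h]

theorem minpoly_rat_eq_map {x : ℝ} (hx : IsIntegral ℤ x) :
    minpoly ℚ x = (minpoly ℤ x).map (algebraMap ℤ ℚ) :=
  minpoly.isIntegrallyClosed_eq_field_fractions' ℚ hx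

theorem minpoly_int_map_real_map_complex {x : ℝ} (hx : IsIntegral ℤ x) :
    ((minpoly ℤ x).map (Int.castRingHom ℝ)).map Complex.ofRealHom =
      (minpoly ℚ x).map (algebraMap ℚ ℂ) := by
  rw [minpoly_rat_eq_map hx, Polynomial.map_map, Polynomial.map_map]
  congr 1

theorem ne_zero_of_aeval_minpoly {α : ℝ} (hα0 : α ≠ 0) (hα : IsIntegral ℚ α) {w : ℂ}
    (hw : aeval w (minpoly ℚ α) = 0) : w ≠ 0 := by
  rintro rfl
  refine minpoly.coeff_zero_ne_zero hα hα0 ?_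
  rw [← coeff_zero_eq_aeval_zero'] at hw
  simpa using hw

theorem im_ne_zero_of_norm_eq_one {α : ℝ} (hα : IsIntegral ℚ α) {w : ℂ}
    (hw : aeval w (minpoly ℚ α) = 0) (h1 : ‖w‖ = 1) (hd : (minpoly ℚ α).natDegree ≠ 1) :
    w.im ≠ 0 := by
  intro him
  have hw' : w = 1 ∨ w = -1 := by
    have : w = (w.re : ℂ) := by apply Complex.ext <;> simp [him]
    rw [this, Complex.norm_real, Real.norm_eq_abs] at h1
    rcases eq_or_eq_neg_of_abs_eq h1 with h | h
    · left; rw [this, h]; simp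
    · right; rw [this, h]; simp
  obtain ⟨c, rfl⟩ : ∃ c : ℚ, w = algebraMap ℚ ℂ c := by
    rcases hw' with h | h
    · exact ⟨1, by simp [h]⟩
    · exact ⟨-1, by simp [h]⟩
  rw [aeval_algebraMap_apply, map_eq_zero] at hw
  have h2 := degree_eq_one_of_irreducible_of_root (minpoly.irreducible hα) (x := c)
    (by rwa [IsRoot, ← coe_aeval_eq_eval])
  exact hd (natDegree_eq_of_degree_eq_some h2)

theorem IsSalem.aeval_inv {α : ℝ} (h : IsSalem α) : aeval α⁻¹ (minpoly ℚ α) = 0 := by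
  obtain ⟨hint, h1, -, z, ⟨hz, -⟩, hz1⟩ := h
  refine aeval_inv_minpoly hint.tower_top hz ?_
  have hconj : z⁻¹ = (starRingEnd ℂ) z := by
    rw [Complex.inv_def, Complex.normSq_eq_norm_sq, hz1]; simp
  have := aeval_algHom_apply (Complex.conjAe.toAlgHom.restrictScalars ℚ) z (minpoly ℚ α)
  rw [hz, map_zero] at this
  rw [hconj]
  exact this

theorem IsSalem.isIntegral_inv {α : ℝ} (h : IsSalem α) : IsIntegral ℤ α⁻¹ := by
  refine ⟨minpoly ℤ α, minpoly.monic h.1, ?_⟩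
  have h2 := h.aeval_inv
  rw [minpoly_rat_eq_map h.1, aeval_map_algebraMap] at h2
  exact h2

theorem IsSalem.norm_eq_one {α : ℝ} (h : IsSalem α) {w : ℂ} (hw : aeval w (minpoly ℚ α) = 0)
    (h1 : w ≠ α) (h2 : w ≠ (α : ℂ)⁻¹) : ‖w‖ = 1 := by
  have hα : IsIntegral ℚ α := h.1.tower_top
  have hα0 : α ≠ 0 := by linarith [h.2.1]
  have hw0 := ne_zero_of_aeval_minpoly hα0 hα hw
  have ha := h.2.2.1 w ⟨hw, h1⟩
  have hb := h.2.2.1 w⁻¹ ⟨aeval_inv_minpoly_of_aeval_inv hα h.aeval_inv hw, fun e => h2 (by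
    rw [← e, inv_inv])⟩
  rw [norm_inv] at hb
  refine le_antisymm ha ?_
  rwa [inv_le_one₀ (norm_pos_iff.2 hw0)] at hb

theorem IsSalem.trace_conj {α : ℝ} (h : IsSalem α) (hd : (minpoly ℚ α).natDegree ≠ 1) {γ : ℂ}
    (hγ : aeval γ (minpoly ℚ (α + α⁻¹)) = 0) :
    γ = ((α + α⁻¹ : ℝ) : ℂ) ∨ ∃ t : ℝ, γ = t ∧ -2 < t ∧ t < 2 := by
  have hα : IsIntegral ℚ α := h.1.tower_top
  obtain ⟨w, hw, rfl⟩ := exists_root_add_inv_eq hα hγ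
  by_cases h1 : w = α
  · left; rw [h1]; push_cast; rfl
  by_cases h2 : w = (α : ℂ)⁻¹
  · left; rw [h2, inv_inv, add_comm]; push_cast; rfl
  right
  have hn := h.norm_eq_one hw h1 h2
  have him := im_ne_zero_of_norm_eq_one hα hw hn hd
  have hconj : w⁻¹ = (starRingEnd ℂ) w := by
    rw [Complex.inv_def, Complex.normSq_eq_norm_sq, hn]; simp
  refine ⟨2 * w.re, ?_, ?_⟩
  · rw [hconj, Complex.add_conj]
  · have := abs_lt.1 ((Complex.abs_re_lt_norm (z := w)).2 him)
    rw [hn] at this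
    constructor <;> linarith

theorem two_lt_add_inv {α : ℝ} (h : 1 < α) : 2 < α + α⁻¹ := by
  have h0 : 0 < α := by linarith
  have : α + α⁻¹ - 2 = (α - 1) ^ 2 / α := by field_simp; ring
  have h2 : 0 < (α - 1) ^ 2 / α := by have := sub_pos.2 h; positivity
  linarith

theorem IsSalem.exists_rootRegion {α : ℝ} {m : ℕ} (h : IsSalem α)
    (hd : (minpoly ℚ α).natDegree = 2 * (m + 1)) :
    IsIntegral ℤ (α + α⁻¹) ∧ ∃ θ ∈ rootRegion m (α + α⁻¹), θ 0 = α + α⁻¹ ∧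
      (minpoly ℤ (α + α⁻¹)).map (Int.castRingHom ℝ) = rootPoly Finset.univ θ := by
  have hα : IsIntegral ℚ α := h.1.tower_top
  have hα0 : α ≠ 0 := by linarith [h.2.1]
  have hβ : IsIntegral ℤ (α + α⁻¹) := h.1.add h.isIntegral_inv
  have hd1 : (minpoly ℚ α).natDegree ≠ 1 := by omega
  refine ⟨hβ, ?_⟩
  have hdeg : (minpoly ℚ (α + α⁻¹)).natDegree = m + 1 := by
    obtain ⟨z, ⟨hz, -⟩, hz1⟩ := h.2.2.2
    have him := im_ne_zero_of_norm_eq_one hα hz hz1 hd1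
    have hconj : z⁻¹ = (starRingEnd ℂ) z := by
      rw [Complex.inv_def, Complex.normSq_eq_norm_sq, hz1]; simp
    have := natDegree_minpoly_eq_two_mul hα0 hα hz him (by rw [hconj]; simp)
    omega
  set p := (minpoly ℤ (α + α⁻¹)).map (Int.castRingHom ℝ) with hp
  have hpm : p.Monic := (minpoly.monic hβ).map _
  have hpd : p.natDegree = m + 1 := by
    rw [← hdeg, minpoly_rat_eq_map hβ, hp, (minpoly.monic hβ).natDegree_map,
      (minpoly.monic hβ).natDegree_map]
  have hpC := minpoly_int_map_real_map_complex hβ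
  rw [← hp] at hpC
  have hroots : ∀ z ∈ (p.map Complex.ofRealHom).roots,
      z = ((α + α⁻¹ : ℝ) : ℂ) ∨ ∃ t : ℝ, z = t ∧ -2 < t ∧ t < 2 := by
    intro z hz
    refine h.trace_conj hd1 ?_
    have := (mem_roots'.1 hz).2
    rwa [hpC, IsRoot, eval_map_algebraMap] at this
  obtain ⟨θ, hθ, hpθ⟩ := exists_strictAnti_rootPoly_eq hpm hpd (by
      rw [hpC]
      exact nodup_roots ((minpoly.irreducible hβ.tower_top).separable.map)) (by
      intro z hz
      rcases hroots z hz with e | ⟨t, e, -⟩ <;> rw [e] <;> exact Complex.ofReal_im _)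
  have hval : ∀ i, θ i = α + α⁻¹ ∨ (-2 < θ i ∧ θ i < 2) := by
    intro i
    have h0 : p.eval (θ i) = 0 := by
      rw [hpθ]; exact (rootPoly_eval_eq_zero_iff θ _).2 ⟨i, rfl⟩
    have h1 : ((θ i : ℝ) : ℂ) ∈ (p.map Complex.ofRealHom).roots := by
      rw [mem_roots (hpm.map _).ne_zero, IsRoot]
      have := eval_map_apply (f := Complex.ofRealHom) (p := p) (x := θ i)
      rw [h0, map_zero] at this
      exact this
    rcases hroots _ h1 with e | ⟨t, e, ht⟩
    · exact Or.inl (Complex.ofReal_injective e)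
    · rw [Complex.ofReal_injective e]; exact Or.inr ht
  have h2 := two_lt_add_inv h.2.1
  have h0 : θ 0 = α + α⁻¹ := by
    have hev : p.eval (α + α⁻¹) = 0 := by
      rw [hp, eval_map]
      exact minpoly.aeval ℤ (α + α⁻¹)
    rw [hpθ] at hev
    obtain ⟨i, hi⟩ := (rootPoly_eval_eq_zero_iff θ _).1 hev
    rcases hval 0 with e | e
    · exact e
    · have := hθ.antitone (Fin.zero_le i)
      rw [hi] at this
      linarith [e.2]
  refine ⟨θ, ⟨hθ, ⟨by rw [h0]; exact h2, h0.le⟩, fun i => ?_⟩, h0, hpθ⟩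
  refine (hval i.succ).resolve_left fun e => ?_
  have := hθ (Fin.succ_pos i)
  rw [e, h0] at this
  exact lt_irrefl _ this

end TracePolynomials

section TracePolynomials
open Polynomial

theorem strictMonoOn_add_inv : StrictMonoOn (fun x : ℝ => x + x⁻¹) (Set.Ici 1) := by
  intro x hx y hy hxy
  rw [Set.mem_Ici] at hx hy
  have hx0 : 0 < x := by linarith
  have hy0 : 0 < y := by linarith
  have : (y + y⁻¹) - (x + x⁻¹) = (y - x) * (x * y - 1) / (x * y) := by field_simp; ring
  have h2 : 0 < (y - x) * (x * y - 1) / (x * y) := by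
    have h3 : 0 < x * y - 1 := by nlinarith
    have h4 := sub_pos.2 hxy
    positivity
  simp only
  linarith

theorem exists_one_lt_add_inv_eq {β : ℝ} (hβ : 2 < β) : ∃ α : ℝ, 1 < α ∧ α + α⁻¹ = β := by
  have h4 : 0 ≤ β ^ 2 - 4 := by nlinarith
  have hs := Real.sq_sqrt h4
  have hs0 := Real.sqrt_nonneg (β ^ 2 - 4)
  set s := Real.sqrt (β ^ 2 - 4)
  refine ⟨(β + s) / 2, by linarith, ?_⟩
  have h0 : β + s ≠ 0 := by positivity
  field_simp
  nlinarith

theorem isIntegral_of_add_inv {α : ℝ} (h0 : α ≠ 0) (h : IsIntegral ℤ (α + α⁻¹)) :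
    IsIntegral ℤ α := by
  let A := integralClosure ℤ ℝ
  have h1 : IsIntegral A α := by
    refine ⟨X ^ 2 - C (⟨α + α⁻¹, h⟩ : A) * X + 1, by monicity!, ?_⟩
    rw [← aeval_def]
    simp only [map_add, map_sub, map_pow, map_mul, aeval_X, aeval_C, map_one]
    change α ^ 2 - (α + α⁻¹) * α + 1 = 0
    field_simp; ring
  exact isIntegral_trans α h1

theorem tracePolys_natDegree {m : ℕ} {B : ℝ} {p : ℤ[X]} (hp : p ∈ tracePolys m B) :
    p.natDegree = m + 1 := by
  obtain ⟨hm, θ, -, h⟩ := hp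
  have := congrArg natDegree h
  rwa [hm.natDegree_map, rootPoly_natDegree, Finset.card_univ, Fintype.card_fin] at this

theorem exists_isSalem_of_irreducible {m : ℕ} (hm : 1 ≤ m) {B : ℝ} {p : ℤ[X]}
    (hp : p ∈ tracePolys m B) (hirr : Irreducible p) :
    ∃ α : ℝ, IsSalem α ∧ (minpoly ℚ α).natDegree = 2 * (m + 1) ∧ α + α⁻¹ ≤ B ∧
      minpoly ℤ (α + α⁻¹) = p := by
  have hpd := tracePolys_natDegree hp
  obtain ⟨hpm, θ, hθ, hpθ⟩ := hp
  obtain ⟨α, hα1, hαβ⟩ := exists_one_lt_add_inv_eq hθ.2.1.1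
  have hα0 : α ≠ 0 := by linarith
  have hev : ∀ x : ℝ, aeval x p = (rootPoly Finset.univ θ).eval x := by
    intro x
    rw [← hpθ, eval_map]
    rfl
  have hβ0 : aeval (α + α⁻¹) p = 0 := by
    rw [hev, hαβ, rootPoly_eval_eq_zero_iff]; exact ⟨0, rfl⟩
  have hβ : IsIntegral ℤ (α + α⁻¹) := ⟨p, hpm, hβ0⟩
  have hαi : IsIntegral ℤ α := isIntegral_of_add_inv hα0 hβ
  have hα : IsIntegral ℚ α := hαi.tower_top
  have hminQ : p.map (algebraMap ℤ ℚ) = minpoly ℚ (α + α⁻¹) := by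
    refine minpoly.eq_of_irreducible_of_monic ?_ (by rwa [aeval_map_algebraMap]) (hpm.map _)
    exact (hpm.irreducible_iff_irreducible_map_fraction_map).1 hirr
  have hmin : minpoly ℤ (α + α⁻¹) = p := by
    refine map_injective (algebraMap ℤ ℚ) (algebraMap ℤ ℚ).injective_int ?_
    rw [hminQ, minpoly_rat_eq_map hβ]
  have hconj : ∀ γ : ℂ, aeval γ (minpoly ℚ (α + α⁻¹)) = 0 ↔ ∃ i, γ = θ i := by
    intro γ
    have h1 : aeval γ (minpoly ℚ (α + α⁻¹)) =
        ((rootPoly Finset.univ θ).map Complex.ofRealHom).eval γ := by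
      rw [← hminQ, ← hpθ, Polynomial.map_map, aeval_map_algebraMap, eval_map]
      rfl
    rw [h1, rootPoly, Polynomial.map_prod, eval_prod, Finset.prod_eq_zero_iff]
    simp [sub_eq_zero]
  have hcases : ∀ w : ℂ, aeval w (minpoly ℚ α) = 0 → w ≠ α → ‖w‖ ≤ 1 := by
    intro w hw hwα
    have hw0 := ne_zero_of_aeval_minpoly hα0 hα hw
    obtain ⟨i, hi⟩ := (hconj _).1 (aeval_add_inv_minpoly hα hw)
    induction i using Fin.cases with
    | zero =>
      rw [← hαβ] at hi
      push_cast at hi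
      rcases eq_or_eq_inv_of_add_inv_eq hw0 (Complex.ofReal_ne_zero.2 hα0) hi with h | h
      · exact absurd h hwα
      · rw [h, norm_inv, Complex.norm_real, Real.norm_eq_abs]
        exact inv_le_one_of_one_le₀ (hα1.le.trans (le_abs_self α))
    | succ i =>
      exact (norm_eq_one_of_add_inv_eq_ofReal hw0 hi (abs_lt.2 (hθ.2.2 i))).1.le
  obtain ⟨w, hw, hwt⟩ := exists_root_add_inv_eq hα ((hconj (θ (Fin.succ ⟨0, hm⟩))).2 ⟨_, rfl⟩)
  have hw0 := ne_zero_of_aeval_minpoly hα0 hα hw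
  obtain ⟨hw1, him⟩ := norm_eq_one_of_add_inv_eq_ofReal hw0 hwt (abs_lt.2 (hθ.2.2 ⟨0, hm⟩))
  refine ⟨α, ⟨hαi, hα1, fun z hz => hcases z hz.1 hz.2, w, ⟨hw, ?_⟩, hw1⟩, ?_, ?_, hmin⟩
  · rintro rfl; exact him (Complex.ofReal_im _)
  · rw [natDegree_minpoly_eq_two_mul hα0 hα hw him (by rw [hwt]; exact Complex.ofReal_im _),
      ← hminQ, hpm.natDegree_map, hpd]
  · rw [hαβ]; exact hθ.2.1.2

theorem rootRegion_mono (m : ℕ) {B B' : ℝ} {θ : Fin (m + 1) → ℝ} (hθ : θ ∈ rootRegion m B)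
    (h : θ 0 ≤ B') : θ ∈ rootRegion m B' := ⟨hθ.1, ⟨hθ.2.1.1, h⟩, hθ.2.2⟩

theorem bijOn_salemSet {m : ℕ} (hm : 1 ≤ m) {H : ℝ} (hH : 1 ≤ H) :
    Set.BijOn (fun α : ℝ => minpoly ℤ (α + α⁻¹)) (salemSet m H)
      {p ∈ tracePolys m (H + H⁻¹) | Irreducible p} := by
  refine ⟨?_, ?_, ?_⟩
  · rintro α ⟨hα, hd, hH'⟩
    obtain ⟨hβ, θ, hθ, h0, hpθ⟩ := hα.exists_rootRegion hd
    refine ⟨⟨minpoly.monic hβ, θ, rootRegion_mono m hθ ?_, hpθ⟩, minpoly.irreducible hβ⟩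
    rw [h0]
    exact strictMonoOn_add_inv.monotoneOn hα.2.1.le hH hH'
  · rintro α ⟨hα, hd, -⟩ α' ⟨hα', hd', -⟩ h
    obtain ⟨hβ, θ, hθ, h0, hpθ⟩ := hα.exists_rootRegion hd
    obtain ⟨hβ', θ', hθ', h0', hpθ'⟩ := hα'.exists_rootRegion hd'
    rw [show minpoly ℤ (α + α⁻¹) = minpoly ℤ (α' + α'⁻¹) from h, hpθ'] at hpθ
    have : θ' = θ := injOn_rootCoeff _ hθ'.1 hθ.1 (by unfold rootCoeff; rw [hpθ])
    refine strictMonoOn_add_inv.injOn hα.2.1.le hα'.2.1.le ?_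
    rw [← h0, ← h0', this]
  · rintro p ⟨hp, hirr⟩
    obtain ⟨α, hα, hd, hB, hmin⟩ := exists_isSalem_of_irreducible hm hp hirr
    refine ⟨α, ⟨hα, hd, ?_⟩, hmin⟩
    exact (strictMonoOn_add_inv.le_iff_le hα.2.1.le hH).1 hB

theorem bijOn_tracePolys (m : ℕ) (B : ℝ) :
    Set.BijOn (fun (p : ℤ[X]) (k : Fin (m + 1)) => p.coeff k) (tracePolys m B)
      {z : Fin (m + 1) → ℤ | (fun i => (z i : ℝ)) ∈ coeffRegion m B} := by
  refine ⟨?_, ?_, ?_⟩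
  · rintro p ⟨-, θ, hθ, h⟩
    refine ⟨θ, hθ, ?_⟩
    ext k
    simp [rootCoeff, ← h]
  · intro p hp q hq h
    have hpd := tracePolys_natDegree hp
    have hqd := tracePolys_natDegree hq
    ext k
    rcases lt_trichotomy k (m + 1) with hk | hk | hk
    · exact congrFun h ⟨k, hk⟩
    · have h1 := hp.1.coeff_natDegree
      have h2 := hq.1.coeff_natDegree
      rw [hpd] at h1; rw [hqd] at h2
      rw [hk, h1, h2]
    · rw [coeff_eq_zero_of_natDegree_lt (by omega), coeff_eq_zero_of_natDegree_lt (by omega)]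
  · rintro z ⟨θ, hθ, hz⟩
    have hlift : rootPoly Finset.univ θ ∈ lifts (Int.castRingHom ℝ) := by
      rw [lifts_iff_coeff_lifts]
      intro k
      rcases lt_trichotomy k (m + 1) with hk | hk | hk
      · exact ⟨z ⟨k, hk⟩, (congrFun hz ⟨k, hk⟩).symm⟩
      · refine ⟨1, ?_⟩
        have := (rootPoly_monic Finset.univ θ).coeff_natDegree
        rw [rootPoly_natDegree, Finset.card_univ, Fintype.card_fin] at this
        rw [hk, this, map_one]
      · refine ⟨0, ?_⟩
        rw [coeff_eq_zero_of_natDegree_lt, map_zero]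
        rwa [rootPoly_natDegree, Finset.card_univ, Fintype.card_fin]
    obtain ⟨q, hq, -, hqm⟩ := lifts_and_natDegree_eq_and_monic hlift (rootPoly_monic _ _)
    refine ⟨q, ⟨hqm, θ, hθ, hq⟩, ?_⟩
    ext k
    have h1 := congrFun hz k
    rw [rootCoeff, ← hq, coeff_map] at h1
    exact Int.cast_injective (α := ℝ) h1

end TracePolynomials

section Reducible
open Polynomial

/-- The monic integer polynomials of degree at most `m` with coefficients of absolute value at
most `R`. -/
def boundedMonicPolys (m : ℕ) (R : ℝ) : Set ℤ[X] :=
  {f | f.Monic ∧ f.natDegree ≤ m ∧ ∀ k, |(f.coeff k : ℝ)| ≤ R}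

theorem boundedMonicPolys_finite_and_ncard_le (m : ℕ) {R : ℝ} (hR : 0 ≤ R) :
    (boundedMonicPolys m R).Finite ∧
      ((boundedMonicPolys m R).ncard : ℝ) ≤ (m + 1) * (2 * R + 1) ^ m := by
  let F : ℤ[X] → ℕ × (Fin m → ℤ) := fun f => (f.natDegree, fun k => f.coeff k)
  let T : Finset (ℕ × (Fin m → ℤ)) :=
    Finset.range (m + 1) ×ˢ Fintype.piFinset fun _ => Finset.Icc (-⌊R⌋) ⌊R⌋
  have hmaps : ∀ f ∈ boundedMonicPolys m R, F f ∈ (T : Set (ℕ × (Fin m → ℤ))) := by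
    rintro f ⟨-, hd, hc⟩
    refine Finset.mem_coe.2 (Finset.mem_product.2 ⟨Finset.mem_range.2 (by simp only [F]; omega),
      Fintype.mem_piFinset.2 fun k => Finset.mem_Icc.2 ?_⟩)
    have := abs_le.1 (hc k)
    refine ⟨neg_le.1 (Int.le_floor.2 ?_), Int.le_floor.2 this.2⟩
    push_cast
    linarith
  have hinj : Set.InjOn F (boundedMonicPolys m R) := by
    rintro f ⟨hf, hfd, -⟩ g ⟨hg, hgd, -⟩ h
    obtain ⟨h1, h2⟩ := Prod.ext_iff.1 h
    dsimp only [F] at h1 h2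
    ext k
    rcases lt_or_ge k m with hk | hk
    · exact congrFun h2 ⟨k, hk⟩
    · rcases eq_or_lt_of_le (hfd.trans hk) with e | e
      · rw [← e, hf.coeff_natDegree, h1, hg.coeff_natDegree]
      · rw [coeff_eq_zero_of_natDegree_lt e, coeff_eq_zero_of_natDegree_lt (h1 ▸ e)]
  refine ⟨Set.Finite.of_injOn hmaps hinj T.finite_toSet, ?_⟩
  have h1 := Set.ncard_le_ncard_of_injOn F hmaps hinj T.finite_toSet
  rw [Set.ncard_coe_finset, Finset.card_product, Finset.card_range, Fintype.card_piFinset] at h1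
  have hfl : 0 ≤ ⌊R⌋ := Int.floor_nonneg.2 hR
  have h2 : ((Finset.Icc (-⌊R⌋) ⌊R⌋).card : ℝ) ≤ 2 * R + 1 := by
    rw [Int.card_Icc, ← Int.cast_natCast (R := ℝ), Int.toNat_of_nonneg (by omega)]
    push_cast
    linarith [Int.floor_le R]
  calc ((boundedMonicPolys m R).ncard : ℝ) ≤
        ((m + 1) * ∏ _i : Fin m, (Finset.Icc (-⌊R⌋) ⌊R⌋).card : ℕ) := by exact_mod_cast h1
    _ = (m + 1) * ((Finset.Icc (-⌊R⌋) ⌊R⌋).card : ℝ) ^ m := by simp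
    _ ≤ _ := by gcongr

/-- A bound for the coefficients of the divisors of a monic polynomial of degree `m` with all its
roots in `[-2, 2]`. -/
noncomputable def divisorCoeffBound (m : ℕ) : ℝ := 2 ^ m * (m.choose (m / 2) : ℝ)

theorem abs_coeff_le_of_dvd_rootPoly {m : ℕ} {τ : Fin m → ℝ} (hτ : τ ∈ cube m) {f : ℝ[X]}
    (hf : f.Monic) (hdvd : f ∣ rootPoly Finset.univ τ) (k : ℕ) :
    |f.coeff k| ≤ divisorCoeffBound m := by
  have hne : rootPoly Finset.univ τ ≠ 0 := (rootPoly_monic _ _).ne_zero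
  have hsplit : (rootPoly Finset.univ τ).Splits :=
    Splits.prod fun i _ => Splits.X_sub_C _
  have h := coeff_bdd_of_roots_le (RingHom.id ℝ) (p := f) (B := 2) (d := m) hf
    (by rw [Polynomial.map_id]; exact hsplit.of_dvd hne hdvd)
    (by
      have := natDegree_le_of_dvd hdvd hne
      rwa [rootPoly_natDegree, Finset.card_univ, Fintype.card_fin] at this)
    (by
      intro z hz
      rw [Polynomial.map_id, mem_roots hf.ne_zero] at hz
      have h0 : (rootPoly Finset.univ τ).eval z = 0 := hz.dvd hdvd
      obtain ⟨i, rfl⟩ := (rootPoly_eval_eq_zero_iff τ z).1 h0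
      rw [Real.norm_eq_abs, abs_le]
      exact mem_cube.1 hτ i) k
  rw [Polynomial.map_id, Real.norm_eq_abs] at h
  refine h.trans_eq ?_
  rw [divisorCoeffBound, max_eq_left (by norm_num)]

theorem mem_boundedMonicPolys_of_mul {m : ℕ} {B : ℝ} (hB : 2 ≤ B) {f g : ℤ[X]} (hf : f.Monic)
    (hg : g.Monic) (hfd : f.natDegree ≤ m) (hgd : g.natDegree ≤ m) {θ : Fin (m + 1) → ℝ}
    (hθ : θ ∈ rootRegion m B)
    (h : (f * g).map (Int.castRingHom ℝ) = rootPoly Finset.univ θ)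
    (h0 : (f.map (Int.castRingHom ℝ)).eval (θ 0) = 0) :
    f ∈ boundedMonicPolys m (2 * divisorCoeffBound m * B) ∧
      g ∈ boundedMonicPolys m (divisorCoeffBound m) := by
  have hτ := tail_mem_cube (rootRegion_subset_closedRootRegion m B hθ)
  obtain ⟨f₁, hf₁⟩ := dvd_iff_isRoot.2 h0
  have hmul : f₁ * g.map (Int.castRingHom ℝ) = rootPoly Finset.univ (Fin.tail θ) := by
    rw [Polynomial.map_mul, hf₁, rootPoly_univ_succ, mul_assoc] at h
    exact mul_left_cancel₀ (X_sub_C_ne_zero _) h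
  have hf₁m : f₁.Monic := by
    refine (monic_X_sub_C (θ 0)).of_mul_monic_left ?_
    rw [← hf₁]; exact hf.map _
  have hc0 : 0 ≤ divisorCoeffBound m := by unfold divisorCoeffBound; positivity
  have hc₁ := abs_coeff_le_of_dvd_rootPoly hτ hf₁m ⟨_, hmul.symm⟩
  have hθ0 : |θ 0| ≤ B := by
    rw [abs_of_pos (by linarith [hθ.2.1.1])]; exact hθ.2.1.2
  have hprod : ∀ k, |θ 0 * f₁.coeff k| ≤ B * divisorCoeffBound m := fun k => by
    rw [abs_mul]; exact mul_le_mul hθ0 (hc₁ k) (abs_nonneg _) (by linarith)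
  refine ⟨⟨hf, hfd, fun k => ?_⟩, hg, hgd, fun k => ?_⟩
  · have e : (f.coeff k : ℝ) = (f.map (Int.castRingHom ℝ)).coeff k := by simp
    rw [e, hf₁]
    cases k with
    | zero =>
      rw [coeff_X_sub_C_mul_zero, abs_neg]
      nlinarith [hprod 0]
    | succ k =>
      rw [coeff_X_sub_C_mul_succ]
      refine (abs_sub _ _).trans ?_
      nlinarith [hprod (k + 1), hc₁ k]
  · have e : (g.coeff k : ℝ) = (g.map (Int.castRingHom ℝ)).coeff k := by simp
    rw [e]
    exact abs_coeff_le_of_dvd_rootPoly hτ (hg.map _) ⟨f₁, by rw [← hmul, mul_comm]⟩ k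

theorem reducible_tracePolys_subset {m : ℕ} {B : ℝ} (hB : 2 ≤ B) :
    {p ∈ tracePolys m B | ¬ Irreducible p} ⊆ (fun q : ℤ[X] × ℤ[X] => q.1 * q.2) ''
      (boundedMonicPolys m (2 * divisorCoeffBound m * B) ×ˢ
        boundedMonicPolys m (divisorCoeffBound m)) := by
  rintro p ⟨hp, hirr⟩
  have hpd := tracePolys_natDegree hp
  obtain ⟨hpm, θ, hθ, hpθ⟩ := hp
  rw [hpm.irreducible_iff_natDegree'] at hirr
  have hp1 : p ≠ 1 := by
    rintro rfl
    simp at hpd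
  push Not at hirr
  obtain ⟨f, g, hf, hg, rfl, hgd⟩ := hirr hp1
  rw [Finset.mem_Ioc] at hgd
  have hdeg := hf.natDegree_mul hg
  have hfd' : f.natDegree ≤ m := by omega
  have hgd' : g.natDegree ≤ m := by omega
  have hev : ((f * g).map (Int.castRingHom ℝ)).eval (θ 0) = 0 := by
    rw [hpθ]; exact (rootPoly_eval_eq_zero_iff θ _).2 ⟨0, rfl⟩
  rw [Polynomial.map_mul, eval_mul] at hev
  rcases mul_eq_zero.1 hev with h0 | h0
  · exact ⟨(f, g), mem_boundedMonicPolys_of_mul hB hf hg hfd' hgd' hθ hpθ h0, rfl⟩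
  · exact ⟨(g, f), mem_boundedMonicPolys_of_mul hB hg hf hgd' hfd' hθ
      (by rwa [mul_comm g f]) h0, mul_comm g f⟩

theorem exists_ncard_reducible_tracePolys_le (m : ℕ) : ∃ C : ℝ, ∀ B : ℝ, 2 ≤ B →
    ({p ∈ tracePolys m B | ¬ Irreducible p}.ncard : ℝ) ≤ C * B ^ m := by
  set c := divisorCoeffBound m with hc
  have hc0 : 0 ≤ c := by rw [hc]; unfold divisorCoeffBound; positivity
  refine ⟨(m + 1) * (4 * c + 1) ^ m * ((m + 1) * (2 * c + 1) ^ m), fun B hB => ?_⟩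
  obtain ⟨hfin1, hcard1⟩ := boundedMonicPolys_finite_and_ncard_le m
    (R := 2 * c * B) (by positivity)
  obtain ⟨hfin2, hcard2⟩ := boundedMonicPolys_finite_and_ncard_le m hc0
  have h1 := (Set.ncard_le_ncard (reducible_tracePolys_subset (m := m) hB)
    ((hfin1.prod hfin2).image _)).trans (Set.ncard_image_le (hfin1.prod hfin2))
  rw [Set.ncard_prod] at h1
  calc ({p ∈ tracePolys m B | ¬ Irreducible p}.ncard : ℝ) ≤
        ((boundedMonicPolys m (2 * c * B)).ncard : ℝ) * (boundedMonicPolys m c).ncard := by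
        exact_mod_cast h1
    _ ≤ ((m + 1) * (2 * (2 * c * B) + 1) ^ m) * ((m + 1) * (2 * c + 1) ^ m) := by gcongr
    _ ≤ ((m + 1) * ((4 * c + 1) * B) ^ m) * ((m + 1) * (2 * c + 1) ^ m) := by
        gcongr; nlinarith
    _ = _ := by rw [mul_pow]; ring

end Reducible

section Counting

theorem tracePolys_finite (m : ℕ) (B : ℝ) : (tracePolys m B).Finite := by
  rw [(bijOn_tracePolys m B).finite_iff_finite]
  exact (finite_intCast_mem (isBounded_coeffRegion m B)).subset
    fun z hz => ⟨_, hz, floorVec_intCast z⟩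

theorem salemSet_finite {m : ℕ} (hm : 1 ≤ m) (H : ℝ) : (salemSet m H).Finite := by
  have h : (salemSet m (max H 1)).Finite :=
    (bijOn_salemSet hm (le_max_right H 1)).finite_iff_finite.2
      ((tracePolys_finite m _).subset fun _ h => h.1)
  exact h.subset fun α hα => ⟨hα.1, hα.2.1, hα.2.2.trans (le_max_left _ _)⟩

theorem ncard_salemSet_add {m : ℕ} (hm : 1 ≤ m) {H : ℝ} (hH : 1 ≤ H) :
    (salemSet m H).ncard + {p ∈ tracePolys m (H + H⁻¹) | ¬ Irreducible p}.ncard =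
      {z : Fin (m + 1) → ℤ | (fun i => (z i : ℝ)) ∈ coeffRegion m (H + H⁻¹)}.ncard := by
  rw [(bijOn_salemSet hm hH).ncard_eq, ← (bijOn_tracePolys m (H + H⁻¹)).ncard_eq]
  have hfin := tracePolys_finite m (H + H⁻¹)
  rw [← Set.ncard_union_eq (Set.disjoint_left.2 fun p h1 h2 => h2.2 h1.2)
    (hfin.subset fun _ h => h.1) (hfin.subset fun _ h => h.1)]
  congr 1
  ext p
  simp only [Set.mem_union, Set.mem_ofPred_eq]
  tauto

theorem pow_succ_sub_pow_succ_le {b h : ℝ} (h0 : 0 ≤ h) (hb : h ≤ b) (hbh : b - h ≤ 1) (n : ℕ) :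
    b ^ (n + 1) - h ^ (n + 1) ≤ (n + 1) * b ^ n := by
  induction n with
  | zero => simpa using hbh
  | succ n ih =>
    have h1 : h ^ (n + 1) ≤ b ^ (n + 1) := pow_le_pow_left₀ h0 hb _
    have h2 : 0 ≤ h ^ (n + 1) := by positivity
    have h3 : 0 ≤ b := h0.trans hb
    calc b ^ (n + 1 + 1) - h ^ (n + 1 + 1) =
          b * (b ^ (n + 1) - h ^ (n + 1)) + h ^ (n + 1) * (b - h) := by ring
      _ ≤ b * ((n + 1) * b ^ n) + b ^ (n + 1) * 1 := by gcongr
      _ = _ := by push_cast; ring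

end Counting

theorem theorem1 (m : ℕ) (hm : 1 ≤ m) :
    (∀ H : ℝ, (salemSet m H).Finite) ∧
      (fun H : ℝ => ((salemSet m H).ncard : ℝ) - salemOmega m * H ^ (m + 1))
        =O[atTop] (fun H : ℝ => H ^ m) := by
  refine ⟨salemSet_finite hm, ?_⟩
  obtain ⟨C₁, h₁⟩ := exists_abs_ncard_coeffRegion_sub_volume_le m
  obtain ⟨C₂, h₂⟩ := abs_volume_coeffRegion_sub_le hm
  obtain ⟨C₃, h₃⟩ := exists_ncard_reducible_tracePolys_le m
  have hω : 0 ≤ salemOmega m := by unfold salemOmega; positivity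
  refine IsBigO.of_bound ((C₁ + C₂ + C₃ + salemOmega m * (m + 1)) * 2 ^ m) ?_
  filter_upwards [eventually_ge_atTop 2] with H hH
  have hH0 : 0 < H := by linarith
  have hinv : H⁻¹ ≤ 1 := inv_le_one_of_one_le₀ (by linarith)
  have hinv0 : 0 < H⁻¹ := inv_pos.2 hH0
  set B := H + H⁻¹ with hB
  have hB2 : 2 ≤ B := by linarith
  have e₁ := abs_le.1 (h₁ B hB2)
  have e₂ := abs_le.1 (h₂ B hB2)
  have e₃ := h₃ B hB2
  have e₄ := pow_succ_sub_pow_succ_le hH0.le (by linarith : H ≤ B) (by linarith) m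
  have e₅ : H ^ (m + 1) ≤ B ^ (m + 1) := pow_le_pow_left₀ hH0.le (by linarith) _
  have e₆ := congrArg (Nat.cast (R := ℝ)) (ncard_salemSet_add hm (H := H) (by linarith))
  rw [← hB] at e₆
  push_cast at e₆
  have e₇ : B ^ m ≤ 2 ^ m * H ^ m := by
    rw [← mul_pow]; exact pow_le_pow_left₀ (by linarith) (by linarith) m
  have e₈ : salemOmega m * (B ^ (m + 1) - H ^ (m + 1)) ≤ salemOmega m * ((m + 1) * B ^ m) := by
    gcongr
  have e₉ : 0 ≤ salemOmega m * (B ^ (m + 1) - H ^ (m + 1)) := mul_nonneg hω (by linarith)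
  have hr0 : (0 : ℝ) ≤ {p ∈ tracePolys m B | ¬ Irreducible p}.ncard := Nat.cast_nonneg _
  have hBm : 0 ≤ B ^ m := by positivity
  have hmain : |((salemSet m H).ncard : ℝ) - salemOmega m * H ^ (m + 1)| ≤
      (C₁ + C₂ + C₃ + salemOmega m * (m + 1)) * B ^ m := by
    have hnn : 0 ≤ salemOmega m * ((m + 1) * B ^ m) := by positivity
    rw [abs_le]
    constructor <;> nlinarith [e₁.1, e₁.2, e₂.1, e₂.2]
  have hC : 0 ≤ C₁ + C₂ + C₃ + salemOmega m * (m + 1) := by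
    have hBp : 0 < B ^ m := by positivity
    exact nonneg_of_mul_nonneg_left ((abs_nonneg _).trans hmain) hBp
  rw [Real.norm_eq_abs, Real.norm_eq_abs, abs_of_pos (pow_pos hH0 m), mul_assoc]
  exact hmain.trans (by gcongr)
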